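/- Let $x_1,\dots,x_n\in\mathbb R^d$ ($n\ge 1$) with $\|x_i\|_2=1$, and let $y\in\mathbb R^n$ with $|y_i|\le C$ for all $i$. Put $$H^\infty_{ij}=\mathbb E_{w\sim N(0,I)}\big[x_i^\top x_j\,\mathbb 1\{w^\top x_i\ge 0,\ w^\top x_j\ge 0\}\big],\qquad \lambda_0=\lambda_{\min}(H^\infty),$$ and assume $\lambda_0>0$. For $W=(w_1,\dots,w_m)\in(\mathbb R^d)^m$ and $a\in\mathbb R^m$ let $$f(W,a,x)=\frac1{\sqrt m}\sum_{r=1}^m a_r\,\sigma(w_r^\top x),\qquad \sigma(z)=\max(z,0),\qquad L(W,a)=\frac12\sum_{i=1}^n\big(f(W,a,x_i)-y_i\big)^2 .$$ A gradient flow of $L$ training both layers on $[0,T]$ is an absolutely continuous curve $t\mapsto(W(t),a(t))$ such that for almost every $t\in[0,T]$ there are $c_{ri}\in[0,1]$, with $c_{ri}=1$ if $w_r(t)^\top x_i>0$ and $c_{ri}=0$ if $w_r(t)^\top x_i<0$, such that for all $r$ $$\dot w_r(t)=-\frac1{\sqrt m}\sum_{i=1}^n (u_i(t)-y_i)\,a_r(t)\,c_{ri}\,x_i,\qquad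 \dot a_r(t)=-\frac1{\sqrt m}\sum_{i=1}^n (u_i(t)-y_i)\,\sigma(w_r(t)^\top x_i),$$ where $u_i(t)=f(W(t),a(t),x_i)$ and $u(t)=(u_1(t),\dots,u_n(t))$. (The choice $c_{ri}=\mathbb 1\{w_r^\top x_i\ge 0\}$ gives the usual gradient formula.) **Theorem.** For every $C$ there is a constant $K>0$, depending only on $C$, such that the following holds for all $n$, $d$, $(x_i)$, $y$ as above, all $\delta\in(0,1)$ and all integers $m\ge 2$ with $$m\ \ge\ K\,\frac{n^6\log(m/\delta)}{\lambda_0^4\,\delta^3}.$$ Let $w_r(0)\sim N(0,I)$ and $a_r(0)\sim\mathrm{unif}\{-1,1\}$, $r=1,\dots,m$, all independent. Then with probability at least $1-\delta$ over this initialization, for every $T\ge 0$, every gradient flow on $[0,T]$ from the initialization, every $t\in[0,T]$ and every $r$, $$\|u(t)-y\|_2^2\le e^{-\lambda_0 t}\,\|u(0)-y\|_2^2,$$ $$\|w_r(t)-w_r(0)\|_2\le\frac{4\sqrt n\,\|y-u(0)\|_2}{\sqrt m\,\lambda_0},\qquad |a_r(t)-a_r(0)|\le\frac{8\sqrt n\,\|y-u(0)\|_2\sqrt{\log(mn/\delta)}}{\sqrt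 m\,\lambda_0}.$$ -/

import Mathlib

open MeasureTheory ProbabilityTheory
open scoped RealInnerProductSpace

noncomputable section

namespace TwoLayerReLU

/-- The ReLU activation `z ↦ z` for `z ≥ 0`, `z ↦ 0` for `z < 0`. -/
def relu (z : ℝ) : ℝ := max z 0

/-- The set of admissible slopes of the ReLU at `z`: `{1}` for `z > 0`, `{0}` for `z < 0` and the
whole interval `[0, 1]` at the kink `z = 0` (the subdifferential of the ReLU). -/
def reluSlope (z : ℝ) : Set ℝ :=
  {c | 0 ≤ c ∧ c ≤ 1 ∧ (0 < z → c = 1) ∧ (z < 0 → c = 0)}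

variable {n m d : ℕ}

/-- The network `f(W, a, x) = m^{-1/2} ∑ r, a_r relu (w_r ⬝ x)`. -/
def net (W : Fin m → EuclideanSpace ℝ (Fin d)) (a : Fin m → ℝ)
    (x : EuclideanSpace ℝ (Fin d)) : ℝ :=
  1 / Real.sqrt m * ∑ r, a r * relu ⟪W r, x⟫

/-- The vector `u ∈ ℝⁿ` of predictions on the inputs `x_1, …, x_n`. -/
def prediction (x : Fin n → EuclideanSpace ℝ (Fin d))
    (W : Fin m → EuclideanSpace ℝ (Fin d)) (a : Fin m → ℝ) : EuclideanSpace ℝ (Fin n) :=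
  WithLp.toLp 2 fun i => net W a (x i)

/-- The derivative of the loss `L(W, a) = ∑ i, (f(W, a, x_i) - y_i)² / 2` in the direction `w_r`,
`m^{-1/2} ∑ i, (f(W, a, x_i) - y_i) a_r c_i x_i`, where `c_i` is the slope used for the ReLU at
`w_r ⬝ x_i`. With `c_i = 𝟙{w_r ⬝ x_i ≥ 0}` it is the usual gradient formula. -/
def gradW (x : Fin n → EuclideanSpace ℝ (Fin d)) (y : EuclideanSpace ℝ (Fin n))
    (W : Fin m → EuclideanSpace ℝ (Fin d)) (a : Fin m → ℝ) (c : Fin n → ℝ) (r : Fin m) :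
    EuclideanSpace ℝ (Fin d) :=
  (1 / Real.sqrt m) • ∑ i, ((net W a (x i) - y i) * a r * c i) • x i

/-- The derivative of the loss in the direction `a_r`,
`m^{-1/2} ∑ i, (f(W, a, x_i) - y_i) relu (w_r ⬝ x_i)`. -/
def gradA (x : Fin n → EuclideanSpace ℝ (Fin d)) (y : EuclideanSpace ℝ (Fin n))
    (W : Fin m → EuclideanSpace ℝ (Fin d)) (a : Fin m → ℝ) (r : Fin m) : ℝ :=
  1 / Real.sqrt m * ∑ i, (net W a (x i) - y i) * relu ⟪W r, x i⟫

/-- `(W, a)` is a gradient flow of the loss in both layers on the time interval `[0, T]`: the curve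
is absolutely continuous and at almost every time
`w_r' = - ∂L/∂w_r` and `a_r' = - ∂L/∂a_r` for all `r`. As the loss is not differentiable where some
`w_r ⬝ x_i = 0`, this is a differential inclusion: every slope in `[0, 1]` is allowed for the ReLU
at its kink. In particular all solutions of the equation with the convention `𝟙{w_r ⬝ x_i ≥ 0}`
are included. -/
structure IsGradientFlow (x : Fin n → EuclideanSpace ℝ (Fin d)) (y : EuclideanSpace ℝ (Fin n))
    (T : ℝ) (W : ℝ → Fin m → EuclideanSpace ℝ (Fin d)) (a : ℝ → Fin m → ℝ) : Prop where
  absCont_W : ∀ r, AbsolutelyContinuousOnInterval (fun t => W t r) 0 T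
  absCont_a : ∀ r, AbsolutelyContinuousOnInterval (fun t => a t r) 0 T
  deriv_W : ∀ᵐ t ∂(volume.restrict (Set.Icc 0 T)), ∃ c : Fin m → Fin n → ℝ,
    (∀ r i, c r i ∈ reluSlope ⟪W t r, x i⟫) ∧
    ∀ r, HasDerivAt (fun s => W s r) (-gradW x y (W t) (a t) (c r) r) t
  deriv_a : ∀ᵐ t ∂(volume.restrict (Set.Icc 0 T)),
    ∀ r, HasDerivAt (fun s => a s r) (-gradA x y (W t) (a t) r) t

open scoped Classical in
/-- The Gram matrix
`H^∞_{ij} = 𝔼_{w ∼ N(0, I)} [x_i ⬝ x_j 𝟙{w ⬝ x_i ≥ 0, w ⬝ x_j ≥ 0}]`. -/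
def gramInf (x : Fin n → EuclideanSpace ℝ (Fin d)) : Matrix (Fin n) (Fin n) ℝ :=
  Matrix.of fun i j =>
    ∫ w, ⟪x i, x j⟫ * (if 0 ≤ ⟪w, x i⟫ ∧ 0 ≤ ⟪w, x j⟫ then 1 else 0)
      ∂(stdGaussian (EuclideanSpace ℝ (Fin d)))

/-- The smallest eigenvalue of a real symmetric matrix (of size at least one); the spectrum is then
a finite nonempty set of reals. -/
def lambdaMin (A : Matrix (Fin n) (Fin n) ℝ) : ℝ := sInf (spectrum ℝ A)

/-- The law of the random initialization: `w_1, …, w_m ∼ N(0, I)` and `a_1, …, a_m` uniform on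
`{-1, 1}`, all independent. -/
def initLaw (m d : ℕ) : Measure ((Fin m → EuclideanSpace ℝ (Fin d)) × (Fin m → ℝ)) :=
  (Measure.pi fun _ => stdGaussian (EuclideanSpace ℝ (Fin d))).prod
    (Measure.pi fun _ => uniformOn ({-1, 1} : Set ℝ))

end TwoLayerReLU

end

/-! Write `e = u - y`. Along the flow the derivative of `‖e‖²` is minus twice the squared norm of
the gradient. The first-layer part alone equals `1/m ∑ a_r² ‖∑ e_i c_ri x_i‖²`, a weighted empirical
Gram form evaluated at `e`. If it is at least `λ₀/2 ‖e‖²`, the loss decays at rate `λ₀`, so both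
layers move at a speed decaying like `exp(-λ₀ t / 2)`, and integrating this speed bounds the total
displacement. The Gram bound survives as long as every `w_r` stays within `R` of its start and every
`a_r` within `1/8`: a slope `c_ri` can then differ from its initial value only if `|w_r(0) ⬝ x_i| ≤
R`, which is rare (`IsGoodInit.gram_le`). For large `m` the displacement bounds lie strictly inside
this region, so a continuous induction shows that the flow never leaves it
(`IsGoodInit.flowBounds`). What remains is probability (`initLaw_badInit_le`). The initial Gram
matrix is close to `H^∞` by Chebyshev, few preactivations are near the kink by Markov, none is large
by a Chernoff bound, and the initial output has second moment at most `n`. Each of these costs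
`δ/4`. The kink needs no separate treatment: at almost every time at which a preactivation vanishes
its derivative vanishes too, so the choice of slope there is immaterial (`hasDerivAt_relu_comp`). -/

/-! ### Absolutely continuous curves -/

namespace AbsolutelyContinuousOnInterval

theorem lipschitz_comp {X Y : Type*} [PseudoMetricSpace X] [PseudoMetricSpace Y] {f : ℝ → X}
    {g : X → Y} {K : NNReal} {a b : ℝ} (hg : LipschitzWith K g)
    (hf : AbsolutelyContinuousOnInterval f a b) :
    AbsolutelyContinuousOnInterval (fun t => g (f t)) a b := by
  refine squeeze_zero (fun t => ?_) (fun t => ?_) (by simpa using Filter.Tendsto.const_mul (K : ℝ) hf)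
  · exact Finset.sum_nonneg fun i _ => dist_nonneg
  · rw [Finset.mul_sum]
    exact Finset.sum_le_sum fun i _ => hg.dist_le_mul _ _

theorem const {X : Type*} [PseudoMetricSpace X] (c : X) (a b : ℝ) :
    AbsolutelyContinuousOnInterval (fun _ => c) a b :=
  ((LipschitzWith.const c).lipschitzOnWith).absolutelyContinuousOnInterval

theorem fun_sum {ι : Type*} (s : Finset ι) {f : ι → ℝ → ℝ} {a b : ℝ}
    (hf : ∀ i, AbsolutelyContinuousOnInterval (f i) a b) :
    AbsolutelyContinuousOnInterval (fun t => ∑ i ∈ s, f i t) a b := by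
  classical
  induction s using Finset.induction_on with
  | empty => simpa using const (0 : ℝ) a b
  | insert i s hi ih =>
    simp only [Finset.sum_insert hi]
    exact (hf i).fun_add ih

theorem inner_const {E : Type*} [NormedAddCommGroup E] [InnerProductSpace ℝ E] {f : ℝ → E}
    {a b : ℝ} (hf : AbsolutelyContinuousOnInterval f a b) (v : E) :
    AbsolutelyContinuousOnInterval (fun t => ⟪f t, v⟫) a b := by
  have h := lipschitz_comp (innerSL ℝ v).lipschitz hf
  simpa [real_inner_comm] using h

/-- The fundamental theorem of calculus for absolutely continuous functions; a sign of the
derivative almost everywhere would not suffice for merely continuous ones. -/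
theorem le_of_ae_deriv_nonpos {f : ℝ → ℝ} {a b : ℝ} (hab : a ≤ b)
    (hf : AbsolutelyContinuousOnInterval f a b)
    (hd : ∀ᵐ t, t ∈ Set.Ico a b → deriv f t ≤ 0) : f b ≤ f a := by
  have h : 0 ≤ ∫ t in a..b, -deriv f t := by
    refine intervalIntegral.integral_nonneg_of_ae_restrict hab ?_
    rw [Filter.EventuallyLE, ← restrict_Ico_eq_restrict_Icc, ae_restrict_iff' measurableSet_Ico]
    filter_upwards [hd] with t ht hts
    simpa using ht hts
  rw [intervalIntegral.integral_neg, hf.integral_deriv_eq_sub] at h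
  linarith

/-- Pairing with the fixed vector `v = f b - f 0` reduces to a scalar statement: `⟪f t, v⟫ + B‖v‖/μ
exp(-μt)` is nonincreasing. Comparing the endpoints gives `‖v‖² ≤ B/μ ‖v‖`, without vector-valued
integration. -/
theorem norm_sub_le_of_exp_decay {E : Type*} [NormedAddCommGroup E] [InnerProductSpace ℝ E]
    {f : ℝ → E} {b B μ : ℝ} (hb : 0 ≤ b) (hB : 0 ≤ B) (hμ : 0 < μ)
    (hf : AbsolutelyContinuousOnInterval f 0 b)
    (hd : ∀ᵐ t, t ∈ Set.Ico 0 b → ∃ f', HasDerivAt f f' t ∧ ‖f'‖ ≤ B * Real.exp (-(μ * t))) :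
    ‖f b - f 0‖ ≤ B / μ := by
  set v := f b - f 0 with hv
  have hexp : ∀ t, HasDerivAt (fun t => B * ‖v‖ / μ * Real.exp (-(μ * t)))
      (-(B * ‖v‖ * Real.exp (-(μ * t)))) t := by
    intro t
    have h := (((hasDerivAt_id t).const_mul μ).fun_neg.exp).const_mul (B * ‖v‖ / μ)
    simp only [id] at h
    refine h.congr_deriv ?_
    field_simp
  have hac : AbsolutelyContinuousOnInterval
      (fun t => ⟪f t, v⟫ + B * ‖v‖ / μ * Real.exp (-(μ * t))) 0 b := by
    refine (hf.inner_const v).fun_add (ContDiffOn.absolutelyContinuousOnInterval ?_)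
    fun_prop
  have h := hac.le_of_ae_deriv_nonpos hb (by
    filter_upwards [hd] with t ht hts
    obtain ⟨f', hf', hle⟩ := ht hts
    have h1 : HasDerivAt (fun t => ⟪f t, v⟫ + B * ‖v‖ / μ * Real.exp (-(μ * t)))
        (⟪f', v⟫ + -(B * ‖v‖ * Real.exp (-(μ * t)))) t := by
      refine HasDerivAt.add ?_ (hexp t)
      have := hf'.inner ℝ (hasDerivAt_const t v)
      simpa using this
    rw [h1.deriv]
    have h2 := real_inner_le_norm f' v
    have h3 := mul_le_mul_of_nonneg_right hle (norm_nonneg v)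
    linarith)
  have h4 : ‖v‖ ^ 2 = ⟪f b, v⟫ - ⟪f 0, v⟫ := by
    rw [← inner_sub_left, ← hv, real_inner_self_eq_norm_sq]
  have h5 : 0 ≤ B * ‖v‖ / μ * Real.exp (-(μ * b)) := by positivity
  simp only [mul_zero, neg_zero, Real.exp_zero, mul_one] at h
  have h6 : ‖v‖ * ‖v‖ ≤ B / μ * ‖v‖ := by
    rw [div_mul_eq_mul_div]; nlinarith
  rcases (norm_nonneg v).eq_or_lt with h0 | h0
  · rw [← h0]; positivity
  · exact le_of_mul_le_mul_right h6 h0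

end AbsolutelyContinuousOnInterval

/-- Continuous induction: a property that fails on a closed set and propagates from `[0, t)` to `t`
holds on the whole interval. -/
theorem forall_Icc_of_forall_Ico {P : ℝ → Prop} {T : ℝ}
    (hc : IsClosed {t | t ∈ Set.Icc 0 T ∧ ¬ P t})
    (h : ∀ t ∈ Set.Icc 0 T, (∀ s ∈ Set.Ico 0 t, P s) → P t) : ∀ t ∈ Set.Icc 0 T, P t := by
  by_contra! hne
  obtain ⟨t, ht, hPt⟩ := hne
  have hcomp : IsCompact {t | t ∈ Set.Icc 0 T ∧ ¬ P t} :=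
    isCompact_Icc.of_isClosed_subset hc fun _ h => h.1
  obtain ⟨t₀, ⟨ht₀, hP₀⟩, hmin⟩ := hcomp.exists_isLeast ⟨t, ht, hPt⟩
  refine hP₀ (h t₀ ht₀ fun s hs => ?_)
  by_contra hPs
  exact absurd (hmin ⟨⟨hs.1, hs.2.le.trans ht₀.2⟩, hPs⟩) (not_le.2 hs.2)

namespace TwoLayerReLU

/-! ### The ReLU and its slopes -/

theorem lipschitzWith_relu : LipschitzWith 1 relu := by
  unfold relu
  exact LipschitzWith.id.max_const 0

theorem abs_relu_le (z : ℝ) : |relu z| ≤ |z| := by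
  unfold relu
  rcases le_total z 0 with h | h <;> simp [h]

/-- Away from the kink this is the chain rule. If `g t = 0`, both `relu ∘ g` and `relu ∘ g - g` are
nonnegative and vanish at `t`, so both have derivative zero there; hence `v = 0` and every `c`
works. -/
theorem hasDerivAt_relu_comp {g : ℝ → ℝ} {t v c : ℝ} (hg : HasDerivAt g v t)
    (hr : DifferentiableAt ℝ (fun s => relu (g s)) t) (hc : c ∈ reluSlope (g t)) :
    HasDerivAt (fun s => relu (g s)) (c * v) t := by
  obtain ⟨-, -, hpos, hneg⟩ := hc
  rcases lt_trichotomy (g t) 0 with h | h | h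
  · rw [hneg h, zero_mul]
    refine (hasDerivAt_const t (0 : ℝ)).congr_of_eventuallyEq ?_
    filter_upwards [hg.continuousAt.eventually_lt continuousAt_const h] with s hs
    exact max_eq_right hs.le
  · have hmin : IsLocalMin (fun s => relu (g s)) t := by
      refine Filter.Eventually.of_forall fun s => ?_
      simp [relu, h]
    have hmin' : IsLocalMin (fun s => relu (g s) - g s) t := by
      refine Filter.Eventually.of_forall fun s => ?_
      simp [relu, h]
    have h0 := hmin.hasDerivAt_eq_zero hr.hasDerivAt
    have h1 := hmin'.hasDerivAt_eq_zero (hr.hasDerivAt.sub hg)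
    have hv : v = 0 := by linarith
    have := hr.hasDerivAt
    rw [h0] at this
    simpa [hv] using this
  · rw [hpos h, one_mul]
    refine hg.congr_of_eventuallyEq ?_
    filter_upwards [continuousAt_const.eventually_lt hg.continuousAt h] with s hs
    exact max_eq_left hs.le

variable {n m d : ℕ}

/-! ### Dynamics of the loss along a gradient flow -/

theorem norm_prediction_sub_sq (x : Fin n → EuclideanSpace ℝ (Fin d)) (y : EuclideanSpace ℝ (Fin n))
    (W : Fin m → EuclideanSpace ℝ (Fin d)) (a : Fin m → ℝ) :
    ‖prediction x W a - y‖ ^ 2 = ∑ i, (net W a (x i) - y i) ^ 2 := by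
  rw [EuclideanSpace.real_norm_sq_eq]
  rfl

theorem absolutelyContinuousOnInterval_net {W : ℝ → Fin m → EuclideanSpace ℝ (Fin d)}
    {a : ℝ → Fin m → ℝ} {T : ℝ}
    (hW : ∀ r, AbsolutelyContinuousOnInterval (fun t => W t r) 0 T)
    (ha : ∀ r, AbsolutelyContinuousOnInterval (fun t => a t r) 0 T)
    (x : EuclideanSpace ℝ (Fin d)) :
    AbsolutelyContinuousOnInterval (fun t => net (W t) (a t) x) 0 T := by
  unfold net
  refine AbsolutelyContinuousOnInterval.const_mul _ (AbsolutelyContinuousOnInterval.fun_sum _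
    fun r => (ha r).fun_mul ?_)
  exact AbsolutelyContinuousOnInterval.lipschitz_comp lipschitzWith_relu ((hW r).inner_const x)

theorem absolutelyContinuousOnInterval_loss {W : ℝ → Fin m → EuclideanSpace ℝ (Fin d)}
    {a : ℝ → Fin m → ℝ} {T : ℝ}
    (hW : ∀ r, AbsolutelyContinuousOnInterval (fun t => W t r) 0 T)
    (ha : ∀ r, AbsolutelyContinuousOnInterval (fun t => a t r) 0 T)
    (x : Fin n → EuclideanSpace ℝ (Fin d)) (y : EuclideanSpace ℝ (Fin n)) :
    AbsolutelyContinuousOnInterval (fun t => ‖prediction x (W t) (a t) - y‖ ^ 2) 0 T := by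
  simp only [norm_prediction_sub_sq]
  simp only [pow_two]
  have h : ∀ i, AbsolutelyContinuousOnInterval (fun t => net (W t) (a t) (x i) - y i) 0 T :=
    fun i => (absolutelyContinuousOnInterval_net hW ha (x i)).fun_sub (.const _ _ _)
  exact AbsolutelyContinuousOnInterval.fun_sum _ fun i => (h i).fun_mul (h i)

/-- At almost every time all the objects in sight are differentiable. -/
theorem IsGradientFlow.ae_deriv {x : Fin n → EuclideanSpace ℝ (Fin d)}
    {y : EuclideanSpace ℝ (Fin n)} {T : ℝ} {W : ℝ → Fin m → EuclideanSpace ℝ (Fin d)}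
    {a : ℝ → Fin m → ℝ} (h : IsGradientFlow x y T W a) (hT : 0 ≤ T) :
    ∀ᵐ t, t ∈ Set.Icc 0 T → ∃ c : Fin m → Fin n → ℝ,
      (∀ r i, c r i ∈ reluSlope ⟪W t r, x i⟫) ∧
      (∀ r, HasDerivAt (fun s => W s r) (-gradW x y (W t) (a t) (c r) r) t) ∧
      (∀ r, HasDerivAt (fun s => a s r) (-gradA x y (W t) (a t) r) t) ∧
      ∀ r i, DifferentiableAt ℝ (fun s => relu ⟪W s r, x i⟫) t := by
  have h1 := (ae_restrict_iff' measurableSet_Icc).1 h.deriv_W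
  have h2 := (ae_restrict_iff' measurableSet_Icc).1 h.deriv_a
  -- The ReLU of a preactivation is itself absolutely continuous, hence differentiable almost
  -- everywhere, including at almost every time spent at the kink.
  have h3 : ∀ᵐ t, ∀ r i, t ∈ Set.uIcc 0 T →
      DifferentiableAt ℝ (fun s => relu ⟪W s r, x i⟫) t := by
    refine ae_all_iff.2 fun r => ae_all_iff.2 fun i => ?_
    exact (AbsolutelyContinuousOnInterval.lipschitz_comp lipschitzWith_relu
      ((h.absCont_W r).inner_const (x i))).ae_differentiableAt
  filter_upwards [h1, h2, h3] with t ht1 ht2 ht3 ht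
  obtain ⟨c, hc, hW⟩ := ht1 ht
  exact ⟨c, hc, hW, ht2 ht, fun r i => ht3 r i (by rwa [Set.uIcc_of_le hT])⟩

/-- The slopes `c` selected by the flow also serve as the slopes in the chain rule, so the energy
identity is exact for any selection. -/
theorem hasDerivAt_loss {x : Fin n → EuclideanSpace ℝ (Fin d)} {y : EuclideanSpace ℝ (Fin n)}
    {W : ℝ → Fin m → EuclideanSpace ℝ (Fin d)} {a : ℝ → Fin m → ℝ} {t : ℝ} {c : Fin m → Fin n → ℝ}
    (hc : ∀ r i, c r i ∈ reluSlope ⟪W t r, x i⟫)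
    (hW : ∀ r, HasDerivAt (fun s => W s r) (-gradW x y (W t) (a t) (c r) r) t)
    (ha : ∀ r, HasDerivAt (fun s => a s r) (-gradA x y (W t) (a t) r) t)
    (hd : ∀ r i, DifferentiableAt ℝ (fun s => relu ⟪W s r, x i⟫) t) :
    HasDerivAt (fun s => ‖prediction x (W s) (a s) - y‖ ^ 2)
      (-2 * ∑ r, (gradA x y (W t) (a t) r ^ 2 + ‖gradW x y (W t) (a t) (c r) r‖ ^ 2)) t := by
  simp only [norm_prediction_sub_sq]
  set e : Fin n → ℝ := fun i => net (W t) (a t) (x i) - y i with he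
  set A : Fin m → ℝ := fun r => gradA x y (W t) (a t) r with hA
  set G : Fin m → EuclideanSpace ℝ (Fin d) := fun r => gradW x y (W t) (a t) (c r) r with hG
  have hrelu : ∀ r i, HasDerivAt (fun s => relu ⟪W s r, x i⟫) (c r i * ⟪-G r, x i⟫) t := by
    intro r i
    refine hasDerivAt_relu_comp ?_ (hd r i) (hc r i)
    simpa using (hW r).inner ℝ (hasDerivAt_const t (x i))
  have hnet : ∀ i, HasDerivAt (fun s => net (W s) (a s) (x i) - y i)
      (1 / Real.sqrt m * ∑ r, (-A r * relu ⟪W t r, x i⟫ + a t r * (c r i * ⟪-G r, x i⟫))) t := by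
    intro i
    refine HasDerivAt.sub_const _ (HasDerivAt.const_mul _ (HasDerivAt.fun_sum fun r _ => ?_))
    exact (ha r).mul (hrelu r i)
  refine (HasDerivAt.fun_sum fun i _ => (hnet i).fun_pow 2).congr_deriv ?_
  -- Only one factor of each square is expanded; the result then matches the terms of `hnet` after
  -- exchanging the sums.
  have hA' : ∀ r, A r ^ 2 = ∑ i, e i * (1 / Real.sqrt m * (A r * relu ⟪W t r, x i⟫)) := by
    intro r
    rw [pow_two]
    nth_rewrite 2 [hA]
    simp only [gradA, Finset.mul_sum]
    exact Finset.sum_congr rfl fun i _ => by ring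
  have hG' : ∀ r, ‖G r‖ ^ 2 =
      ∑ i, e i * (1 / Real.sqrt m * (a t r * (c r i * ⟪G r, x i⟫))) := by
    intro r
    rw [← real_inner_self_eq_norm_sq]
    nth_rewrite 2 [hG]
    simp only [gradW, inner_smul_right, inner_sum, Finset.mul_sum]
    exact Finset.sum_congr rfl fun i _ => by ring
  change _ = -2 * ∑ r, (A r ^ 2 + ‖G r‖ ^ 2)
  simp only [hA', hG', ← Finset.sum_add_distrib]
  rw [Finset.sum_comm, Finset.mul_sum]
  refine Finset.sum_congr rfl fun i _ => ?_
  simp only [inner_neg_left, Finset.mul_sum]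
  refine Finset.sum_congr rfl fun r _ => ?_
  simp only [he]
  push_cast
  ring

theorem abs_sum_mul_le (v : EuclideanSpace ℝ (Fin n)) {b : Fin n → ℝ} {B : ℝ}
    (hb : ∀ i, |b i| ≤ B) : ∑ i, |v i * b i| ≤ Real.sqrt n * ‖v‖ * B := by
  have h1 : ∑ i, |v i| ≤ Real.sqrt n * ‖v‖ := by
    refine abs_le_of_sq_le_sq' ?_ (by positivity) |>.2
    rw [mul_pow, Real.sq_sqrt (Nat.cast_nonneg n), EuclideanSpace.real_norm_sq_eq]
    simpa using sq_sum_le_card_mul_sum_sq (s := Finset.univ) (f := fun i => |v i|)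
  calc ∑ i, |v i * b i| ≤ ∑ i, |v i| * B := by
        refine Finset.sum_le_sum fun i _ => ?_
        rw [abs_mul]
        exact mul_le_mul_of_nonneg_left (hb i) (abs_nonneg _)
    _ = (∑ i, |v i|) * B := (Finset.sum_mul _ _ _).symm
    _ ≤ _ := by
        -- For `n = 0` nothing forces `B ≥ 0`, but both sides vanish.
        rcases n.eq_zero_or_pos with rfl | hn
        · simp
        · exact mul_le_mul_of_nonneg_right h1 ((abs_nonneg _).trans (hb ⟨0, hn⟩))

theorem abs_gradA_le (x : Fin n → EuclideanSpace ℝ (Fin d)) (y : EuclideanSpace ℝ (Fin n))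
    (W : Fin m → EuclideanSpace ℝ (Fin d)) (a : Fin m → ℝ) (r : Fin m) {M : ℝ}
    (hM : ∀ i, |⟪W r, x i⟫| ≤ M) :
    |gradA x y W a r| ≤ Real.sqrt n * M / Real.sqrt m * ‖prediction x W a - y‖ := by
  have h := abs_sum_mul_le (prediction x W a - y) (fun i => (abs_relu_le _).trans (hM i))
  unfold gradA
  rw [abs_mul, abs_of_nonneg (by positivity : 0 ≤ 1 / Real.sqrt m)]
  calc _ ≤ 1 / Real.sqrt m * (Real.sqrt n * ‖prediction x W a - y‖ * M) :=
        mul_le_mul_of_nonneg_left ((Finset.abs_sum_le_sum_abs _ _).trans h) (by positivity)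
    _ = _ := by ring

theorem norm_gradW_le {x : Fin n → EuclideanSpace ℝ (Fin d)} (hx : ∀ i, ‖x i‖ = 1)
    (y : EuclideanSpace ℝ (Fin n)) (W : Fin m → EuclideanSpace ℝ (Fin d)) (a : Fin m → ℝ)
    {c : Fin n → ℝ} (r : Fin m) (hc : ∀ i, |c i| ≤ 1) {M : ℝ} (hM : |a r| ≤ M) :
    ‖gradW x y W a c r‖ ≤ Real.sqrt n * M / Real.sqrt m * ‖prediction x W a - y‖ := by
  have h := abs_sum_mul_le (prediction x W a - y) (b := fun i => a r * c i) (B := M) (fun i => by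
    rw [abs_mul]
    nlinarith [hc i, abs_nonneg (a r), abs_nonneg (c i)])
  unfold gradW
  rw [norm_smul, Real.norm_of_nonneg (by positivity : 0 ≤ 1 / Real.sqrt m)]
  calc _ ≤ 1 / Real.sqrt m * (Real.sqrt n * ‖prediction x W a - y‖ * M) := by
        refine mul_le_mul_of_nonneg_left ((norm_sum_le _ _).trans (le_trans (le_of_eq ?_) h))
          (by positivity)
        refine Finset.sum_congr rfl fun i _ => ?_
        rw [norm_smul, hx, mul_one, Real.norm_eq_abs, mul_assoc]
        rfl
    _ = _ := by ring

/-! ### Good initializations and the flow started from them -/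

/-- The slope `𝟙{z ≥ 0}` of the ReLU. -/
noncomputable def step (z : ℝ) : ℝ := if 0 ≤ z then 1 else 0

theorem abs_step_le (z : ℝ) : |step z| ≤ 1 := by
  unfold step
  split_ifs <;> simp

/-- The indicator of `|z| ≤ R`. -/
noncomputable def nearZero (R z : ℝ) : ℝ := if |z| ≤ R then 1 else 0

theorem nearZero_nonneg (R z : ℝ) : 0 ≤ nearZero R z := by
  unfold nearZero
  split_ifs <;> simp

theorem abs_le_one_of_mem_reluSlope {z c : ℝ} (hc : c ∈ reluSlope z) : |c| ≤ 1 :=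
  abs_le.2 ⟨by linarith [hc.1], hc.2.1⟩

/-- A preactivation that starts farther than `R` from zero keeps its sign under a move of at most
`R`, so its slope is unchanged. -/
theorem abs_slope_sub_step_le {z z' c R : ℝ} (hc : c ∈ reluSlope z') (h : |z' - z| ≤ R) :
    |step z - c| ≤ nearZero R z := by
  obtain ⟨h0, h1, hpos, hneg⟩ := hc
  obtain ⟨hl, hu⟩ := abs_le.1 h
  unfold step nearZero
  by_cases hz : |z| ≤ R
  · rw [if_pos hz, abs_le]
    split_ifs <;> constructor <;> linarith
  · rw [if_neg hz]
    rcases lt_abs.1 (not_le.1 hz) with hz | hz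
    · rw [if_pos (by linarith [(abs_nonneg _).trans h]), hpos (by linarith)]
      simp
    · rw [if_neg (by linarith [(abs_nonneg _).trans h]), hneg (by linarith)]
      simp

/-- The conditions on the initialization under which the flow converges. -/
structure IsGoodInit (x : Fin n → EuclideanSpace ℝ (Fin d)) (lam R M : ℝ)
    (W₀ : Fin m → EuclideanSpace ℝ (Fin d)) (a₀ : Fin m → ℝ) : Prop where
  sign : ∀ r, |a₀ r| = 1
  gram : ∀ v : EuclideanSpace ℝ (Fin n), 7 / 8 * lam * ‖v‖ ^ 2 ≤
    1 / m * ∑ r, ‖∑ i, (v i * step ⟪W₀ r, x i⟫) • x i‖ ^ 2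
  margin : ∑ r, ∑ i, nearZero R ⟪W₀ r, x i⟫ ≤ m * lam / (16 * n)
  bound : ∀ r i, |⟪W₀ r, x i⟫| ≤ M

theorem norm_sum_smul_le {x : Fin n → EuclideanSpace ℝ (Fin d)} (hx : ∀ i, ‖x i‖ = 1)
    (v : EuclideanSpace ℝ (Fin n)) {c : Fin n → ℝ} (hc : ∀ i, |c i| ≤ 1) :
    ‖∑ i, (v i * c i) • x i‖ ≤ Real.sqrt n * ‖v‖ := by
  have h := abs_sum_mul_le v hc
  rw [mul_one] at h
  refine (norm_sum_le _ _).trans (le_trans (le_of_eq ?_) h)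
  exact Finset.sum_congr rfl fun i _ => by rw [norm_smul, hx, mul_one, Real.norm_eq_abs]

theorem norm_sum_smul_sub_le {x : Fin n → EuclideanSpace ℝ (Fin d)} (hx : ∀ i, ‖x i‖ = 1)
    (v : EuclideanSpace ℝ (Fin n)) {c s b : Fin n → ℝ} (h : ∀ i, |s i - c i| ≤ b i) :
    ‖∑ i, (v i * s i) • x i - ∑ i, (v i * c i) • x i‖ ≤ ‖v‖ * ∑ i, b i := by
  rw [← Finset.sum_sub_distrib, Finset.mul_sum]
  refine (norm_sum_le _ _).trans (Finset.sum_le_sum fun i _ => ?_)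
  rw [← sub_smul, ← mul_sub, norm_smul, hx, mul_one, norm_mul]
  exact mul_le_mul (PiLp.norm_apply_le v i) (h i) (norm_nonneg _) (norm_nonneg _)

/-- The form is compared neuron by neuron. With `q`, `p` the initial and current norms and `b` the
number of inputs near the kink, `q - p ≤ ‖v‖ b` and `q + p ≤ 2√n ‖v‖`. By the margin condition the
average loss in `q²` is at most `lam/8 ‖v‖²`. Since `a_r² ≥ 49/64`, what is left is `(7/8 - 1/8) ·
49/64 = 147/256 > 1/2`. -/
theorem IsGoodInit.gram_le {x : Fin n → EuclideanSpace ℝ (Fin d)} {lam R M : ℝ}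
    {W₀ W : Fin m → EuclideanSpace ℝ (Fin d)} {a₀ a : Fin m → ℝ} {c : Fin m → Fin n → ℝ}
    (h : IsGoodInit x lam R M W₀ a₀) (hn : 0 < n) (hm : 0 < m) (hlam : 0 < lam)
    (hx : ∀ i, ‖x i‖ = 1) (hW : ∀ r, ‖W r - W₀ r‖ ≤ R) (ha : ∀ r, |a r - a₀ r| ≤ 1 / 8)
    (hc : ∀ r i, c r i ∈ reluSlope ⟪W r, x i⟫) (v : EuclideanSpace ℝ (Fin n)) :
    lam / 2 * ‖v‖ ^ 2 ≤ 1 / m * ∑ r, a r ^ 2 * ‖∑ i, (v i * c r i) • x i‖ ^ 2 := by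
  have hm' : (0 : ℝ) < m := by exact_mod_cast hm
  have hn' : (1 : ℝ) ≤ n := by exact_mod_cast hn
  have hterm : ∀ r, ‖∑ i, (v i * step ⟪W₀ r, x i⟫) • x i‖ ^ 2 -
      2 * Real.sqrt n * ‖v‖ ^ 2 * ∑ i, nearZero R ⟪W₀ r, x i⟫ ≤
      ‖∑ i, (v i * c r i) • x i‖ ^ 2 := by
    intro r
    have h1 := norm_sum_smul_sub_le hx v (fun i => abs_slope_sub_step_le (hc r i)
      (z := ⟪W₀ r, x i⟫) (R := R) (by
        rw [← inner_sub_left]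
        refine (abs_real_inner_le_norm _ _).trans ?_
        rw [hx, mul_one]
        exact hW r))
    have h2 := norm_sum_smul_le hx v (c := fun i => step ⟪W₀ r, x i⟫) (fun i => abs_step_le _)
    have h3 := norm_sum_smul_le hx v (fun i => abs_le_one_of_mem_reluSlope (hc r i))
    have h4 := norm_sub_norm_le (∑ i, (v i * step ⟪W₀ r, x i⟫) • x i)
      (∑ i, (v i * c r i) • x i)
    set p := ‖∑ i, (v i * c r i) • x i‖
    set q := ‖∑ i, (v i * step ⟪W₀ r, x i⟫) • x i‖
    have hp : 0 ≤ p := norm_nonneg _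
    have hq : 0 ≤ q := norm_nonneg _
    set b := ∑ i, nearZero R ⟪W₀ r, x i⟫ with hb
    have hb0 : 0 ≤ b := Finset.sum_nonneg fun i _ => nearZero_nonneg _ _
    have h5 : q - p ≤ ‖v‖ * b := h4.trans h1
    have h6 : (q - p) * (q + p) ≤ (‖v‖ * b) * (2 * (Real.sqrt n * ‖v‖)) :=
      (mul_le_mul_of_nonneg_right h5 (by positivity)).trans
        (mul_le_mul_of_nonneg_left (by linarith) (by positivity))
    nlinarith
  have ha2 : ∀ r, 49 / 64 ≤ a r ^ 2 := by
    intro r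
    have h1 := abs_sub_abs_le_abs_sub (a₀ r) (a r)
    rw [h.sign, abs_sub_comm] at h1
    have h2 : 7 / 8 ≤ |a r| := by linarith [ha r]
    rw [← sq_abs]
    nlinarith
  have hsum : ∑ r, ‖∑ i, (v i * step ⟪W₀ r, x i⟫) • x i‖ ^ 2 -
      2 * Real.sqrt n * ‖v‖ ^ 2 * ∑ r, ∑ i, nearZero R ⟪W₀ r, x i⟫ ≤
      ∑ r, ‖∑ i, (v i * c r i) • x i‖ ^ 2 := by
    rw [Finset.mul_sum, ← Finset.sum_sub_distrib]
    exact Finset.sum_le_sum fun r _ => hterm r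
  have hsum2 : 49 / 64 * ∑ r, ‖∑ i, (v i * c r i) • x i‖ ^ 2 ≤
      ∑ r, a r ^ 2 * ‖∑ i, (v i * c r i) • x i‖ ^ 2 := by
    rw [Finset.mul_sum]
    exact Finset.sum_le_sum fun r _ => mul_le_mul_of_nonneg_right (ha2 r) (by positivity)
  have hg := h.gram v
  rw [one_div, inv_mul_eq_div, le_div_iff₀ hm'] at hg ⊢
  have hsqrt : Real.sqrt n ≤ n := by
    rw [Real.sqrt_le_left (by positivity)]
    nlinarith
  have hmar : 2 * Real.sqrt n * ‖v‖ ^ 2 * ∑ r, ∑ i, nearZero R ⟪W₀ r, x i⟫ ≤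
      m * lam / 8 * ‖v‖ ^ 2 := by
    calc _ ≤ 2 * Real.sqrt n * ‖v‖ ^ 2 * (m * lam / (16 * n)) :=
          mul_le_mul_of_nonneg_left h.margin (by positivity)
      _ ≤ 2 * n * ‖v‖ ^ 2 * (m * lam / (16 * n)) := by gcongr
      _ = _ := by field_simp; ring
  have hpos : 0 ≤ m * lam * ‖v‖ ^ 2 := by positivity
  nlinarith

/-- Identifies the first-layer part of the dissipation with the form bounded in
`IsGoodInit.gram_le`, at `v = u - y`. -/
theorem norm_gradW_sq (x : Fin n → EuclideanSpace ℝ (Fin d)) (y : EuclideanSpace ℝ (Fin n))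
    (W : Fin m → EuclideanSpace ℝ (Fin d)) (a : Fin m → ℝ) (c : Fin n → ℝ) (r : Fin m) :
    ‖gradW x y W a c r‖ ^ 2 =
      1 / m * (a r ^ 2 * ‖∑ i, ((prediction x W a - y) i * c i) • x i‖ ^ 2) := by
  have h : gradW x y W a c r =
      (1 / Real.sqrt m * a r) • ∑ i, ((prediction x W a - y) i * c i) • x i := by
    unfold gradW
    rw [mul_smul, Finset.smul_sum (r := a r)]
    congr 1
    refine Finset.sum_congr rfl fun i _ => ?_
    rw [smul_smul]
    congr 1
    simp only [prediction, PiLp.sub_apply]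
    ring
  rw [h, norm_smul, mul_pow, Real.norm_eq_abs, sq_abs, mul_pow, div_pow,
    Real.sq_sqrt (Nat.cast_nonneg m)]
  ring

/-- The conclusion of the convergence theorem at time `t`, with `L` for the logarithmic factor. -/
def FlowBounds (x : Fin n → EuclideanSpace ℝ (Fin d)) (y : EuclideanSpace ℝ (Fin n)) (lam L : ℝ)
    (W : ℝ → Fin m → EuclideanSpace ℝ (Fin d)) (a : ℝ → Fin m → ℝ) (t : ℝ) : Prop :=
  ‖prediction x (W t) (a t) - y‖ ^ 2 ≤
    Real.exp (-lam * t) * ‖prediction x (W 0) (a 0) - y‖ ^ 2 ∧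
  (∀ r, ‖W t r - W 0 r‖ ≤
    4 * Real.sqrt n * ‖y - prediction x (W 0) (a 0)‖ / (Real.sqrt m * lam)) ∧
  (∀ r, |a t r - a 0 r| ≤
    8 * Real.sqrt n * ‖y - prediction x (W 0) (a 0)‖ * L / (Real.sqrt m * lam))

/-- Confinement is needed only on `[0, t)`, since derivatives enter only almost everywhere; this is
the form that the continuous induction requires. -/
theorem IsGoodInit.flowBounds_of_confined {x : Fin n → EuclideanSpace ℝ (Fin d)}
    {y : EuclideanSpace ℝ (Fin n)} {lam R M L T : ℝ}
    {W : ℝ → Fin m → EuclideanSpace ℝ (Fin d)} {a : ℝ → Fin m → ℝ}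
    (h : IsGoodInit x lam R M (W 0) (a 0)) (hn : 0 < n) (hm : 0 < m) (hlam : 0 < lam)
    (hR : 0 < R) (hx : ∀ i, ‖x i‖ = 1) (hML : M + R ≤ 4 * L)
    (hflow : IsGradientFlow x y T W a) {t : ℝ} (ht : t ∈ Set.Icc 0 T)
    (hconf : ∀ s ∈ Set.Ico 0 t, ∀ r, ‖W s r - W 0 r‖ < R ∧ |a s r - a 0 r| < 1 / 8) :
    FlowBounds x y lam L W a t := by
  have hT : 0 ≤ T := ht.1.trans ht.2
  have hae := hflow.ae_deriv hT
  have hsub : ∀ s ∈ Set.Icc 0 t, Set.uIcc 0 s ⊆ Set.uIcc 0 T := fun s hs => by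
    rw [Set.uIcc_of_le hs.1, Set.uIcc_of_le hT]
    exact Set.Icc_subset_Icc_right (hs.2.trans ht.2)
  set φ : ℝ → ℝ := fun s => ‖prediction x (W s) (a s) - y‖ ^ 2 with hφ
  have hdecay : ∀ s ∈ Set.Icc 0 t, φ s ≤ Real.exp (-lam * s) * φ 0 := by
    intro s hs
    -- Grönwall by an integrating factor: `exp(lam u) φ(u)` is nonincreasing.
    have hac : AbsolutelyContinuousOnInterval (fun u => Real.exp (lam * u) * φ u) 0 s := by
      refine AbsolutelyContinuousOnInterval.fun_mul
        (ContDiffOn.absolutelyContinuousOnInterval (by fun_prop)) ?_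
      exact (absolutelyContinuousOnInterval_loss hflow.absCont_W hflow.absCont_a x y).mono
        (hsub s hs)
    have hle := hac.le_of_ae_deriv_nonpos hs.1 (by
      filter_upwards [hae] with u hu hus
      have hut : u ∈ Set.Ico 0 t := ⟨hus.1, hus.2.trans_le hs.2⟩
      obtain ⟨c, hc, hW, ha, hd⟩ := hu ⟨hut.1, hut.2.le.trans ht.2⟩
      have h1 := hasDerivAt_loss hc hW ha hd
      have h2 : HasDerivAt (fun u => Real.exp (lam * u)) (Real.exp (lam * u) * (lam * 1)) u :=
        ((hasDerivAt_id u).const_mul lam).exp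
      rw [(h2.fun_mul h1).deriv]
      have h3 := h.gram_le hn hm hlam hx (fun r => (hconf u hut r).1.le)
        (fun r => (hconf u hut r).2.le) hc (prediction x (W u) (a u) - y)
      have h4 : lam / 2 * φ u ≤
          ∑ r, (gradA x y (W u) (a u) r ^ 2 + ‖gradW x y (W u) (a u) (c r) r‖ ^ 2) := by
        refine h3.trans ?_
        rw [Finset.mul_sum]
        refine Finset.sum_le_sum fun r _ => ?_
        rw [norm_gradW_sq]
        exact le_add_of_nonneg_left (sq_nonneg _)
      have h5 := (Real.exp_pos (lam * u)).le
      have h6 : 0 ≤ Real.exp (lam * u) *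
          (∑ r, (gradA x y (W u) (a u) r ^ 2 + ‖gradW x y (W u) (a u) (c r) r‖ ^ 2) -
            lam / 2 * φ u) := mul_nonneg h5 (sub_nonneg.2 h4)
      change Real.exp (lam * u) * (lam * 1) * φ u + _ ≤ 0
      linarith)
    simp only [mul_zero, Real.exp_zero, one_mul] at hle
    rw [neg_mul, Real.exp_neg, inv_mul_eq_div, le_div_iff₀ (Real.exp_pos _)]
    linarith
  have hnorm : ∀ s ∈ Set.Ico 0 t, ‖prediction x (W s) (a s) - y‖ ≤
      ‖prediction x (W 0) (a 0) - y‖ * Real.exp (-(lam / 2 * s)) := by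
    intro s hs
    refine abs_le_of_sq_le_sq' ((hdecay s ⟨hs.1, hs.2.le⟩).trans (le_of_eq ?_))
      (by positivity) |>.2
    rw [mul_pow, ← Real.exp_nat_mul, mul_comm]
    congr 2
    push_cast
    ring
  have hhalf : 0 < lam / 2 := by positivity
  have hm' : (0 : ℝ) < Real.sqrt m := Real.sqrt_pos.2 (by exact_mod_cast hm)
  have ht' := hsub t ⟨ht.1, le_rfl⟩
  refine ⟨hdecay t ⟨ht.1, le_rfl⟩, fun r => ?_, fun r => ?_⟩
  -- The factor 4 is `|a_r| ≤ 2` divided by the rate `lam/2`, which is half of `lam` because the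
  -- norm, not its square, is integrated.
  · have hb := ((hflow.absCont_W r).mono ht').norm_sub_le_of_exp_decay ht.1
      (B := 2 * Real.sqrt n / Real.sqrt m * ‖prediction x (W 0) (a 0) - y‖) (by positivity) hhalf
      (by
        filter_upwards [hae] with s hs hst
        obtain ⟨c, hc, hW, -, -⟩ := hs ⟨hst.1, hst.2.le.trans ht.2⟩
        refine ⟨_, hW r, ?_⟩
        rw [norm_neg]
        have ha2 : |a s r| ≤ 2 := by
          have h1 := abs_sub_abs_le_abs_sub (a s r) (a 0 r)
          rw [h.sign] at h1
          linarith [(hconf s hst r).2]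
        refine (norm_gradW_le hx y (W s) (a s) r (fun i => abs_le_one_of_mem_reluSlope (hc r i))
          ha2).trans ?_
        rw [mul_assoc, mul_comm (Real.sqrt n)]
        exact mul_le_mul_of_nonneg_left (hnorm s hst) (by positivity))
    refine hb.trans (le_of_eq ?_)
    rw [norm_sub_rev y]
    field_simp
    ring
  · have hMR : 0 ≤ M + R := by linarith [(abs_nonneg _).trans (h.bound r ⟨0, hn⟩)]
    -- Preactivations stay below `M + R ≤ 4 L`; division by `lam/2` gives the factor 8.
    have hb := ((hflow.absCont_a r).mono ht').norm_sub_le_of_exp_decay ht.1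
      (B := Real.sqrt n * (M + R) / Real.sqrt m * ‖prediction x (W 0) (a 0) - y‖)
      (by positivity) hhalf
      (by
        filter_upwards [hae] with s hs hst
        obtain ⟨c, -, -, ha, -⟩ := hs ⟨hst.1, hst.2.le.trans ht.2⟩
        refine ⟨_, ha r, ?_⟩
        rw [norm_neg]
        refine (abs_gradA_le x y (W s) (a s) r (M := M + R) fun i => ?_).trans ?_
        · have h1 : ⟪W s r, x i⟫ = ⟪W 0 r, x i⟫ + ⟪W s r - W 0 r, x i⟫ := by
            rw [← inner_add_left, add_sub_cancel]
          have h2 := abs_real_inner_le_norm (W s r - W 0 r) (x i)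
          rw [hx, mul_one] at h2
          rw [h1]
          exact (abs_add_le _ _).trans (add_le_add (h.bound r i) (h2.trans (hconf s hst r).1.le))
        · rw [mul_assoc]
          exact mul_le_mul_of_nonneg_left (hnorm s hst) (by positivity))
    refine hb.trans ?_
    rw [norm_sub_rev y, div_le_div_iff₀ hhalf (by positivity)]
    have h1 : Real.sqrt n * (M + R) / Real.sqrt m * ‖prediction x (W 0) (a 0) - y‖ *
        (Real.sqrt m * lam) =
        Real.sqrt n * ‖prediction x (W 0) (a 0) - y‖ * lam * (M + R) := by
      field_simp
    have h2 := mul_le_mul_of_nonneg_left hML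
      (by positivity : 0 ≤ Real.sqrt n * ‖prediction x (W 0) (a 0) - y‖ * lam)
    rw [h1]
    linarith

/-- Strictness of `hWlt` and `halt` closes the bootstrap: confinement before `t` gives bounds at `t`
that lie strictly inside the confining region, so there is no first exit time. -/
theorem IsGoodInit.flowBounds {x : Fin n → EuclideanSpace ℝ (Fin d)}
    {y : EuclideanSpace ℝ (Fin n)} {lam R M L T : ℝ}
    {W : ℝ → Fin m → EuclideanSpace ℝ (Fin d)} {a : ℝ → Fin m → ℝ}
    (h : IsGoodInit x lam R M (W 0) (a 0)) (hn : 0 < n) (hm : 0 < m) (hlam : 0 < lam)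
    (hR : 0 < R) (hx : ∀ i, ‖x i‖ = 1) (hML : M + R ≤ 4 * L)
    (hWlt : 4 * Real.sqrt n * ‖y - prediction x (W 0) (a 0)‖ / (Real.sqrt m * lam) < R)
    (halt : 8 * Real.sqrt n * ‖y - prediction x (W 0) (a 0)‖ * L / (Real.sqrt m * lam) < 1 / 8)
    (hflow : IsGradientFlow x y T W a) {t : ℝ} (ht : t ∈ Set.Icc 0 T) :
    FlowBounds x y lam L W a t := by
  have hT : 0 ≤ T := ht.1.trans ht.2
  have hconf : ∀ t ∈ Set.Icc 0 T,
      ∀ r, ‖W t r - W 0 r‖ < R ∧ |a t r - a 0 r| < 1 / 8 := by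
    refine forall_Icc_of_forall_Ico ?_ fun t ht hs r => ?_
    · have hset : {t | t ∈ Set.Icc 0 T ∧ ¬ ∀ r, ‖W t r - W 0 r‖ < R ∧ |a t r - a 0 r| < 1 / 8} =
          ⋃ r, ((Set.Icc 0 T ∩ (fun t => ‖W t r - W 0 r‖) ⁻¹' Set.Ici R) ∪
            (Set.Icc 0 T ∩ (fun t => |a t r - a 0 r|) ⁻¹' Set.Ici (1 / 8))) := by
        ext t
        simp only [Set.mem_ofPred_eq, Set.mem_iUnion, Set.mem_union, Set.mem_inter_iff,
          Set.mem_preimage, Set.mem_Ici, not_forall, not_and_or, not_lt, ← and_or_left,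
          exists_and_left]
      rw [hset]
      refine isClosed_iUnion_of_finite fun r => ?_
      have h1 := (hflow.absCont_W r).continuousOn
      have h2 := (hflow.absCont_a r).continuousOn
      rw [Set.uIcc_of_le hT] at h1 h2
      exact ((h1.sub continuousOn_const).norm.preimage_isClosed_of_isClosed isClosed_Icc
        isClosed_Ici).union ((h2.sub continuousOn_const).abs.preimage_isClosed_of_isClosed
        isClosed_Icc isClosed_Ici)
    · have hb := h.flowBounds_of_confined hn hm hlam hR hx hML hflow ht hs
      exact ⟨(hb.2.1 r).trans_lt hWlt, (hb.2.2 r).trans_lt halt⟩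
  exact h.flowBounds_of_confined hn hm hlam hR hx hML hflow ht fun s hs =>
    hconf s ⟨hs.1, hs.2.le.trans ht.2⟩

/-! ### The standard Gaussian and the Rademacher distribution -/

theorem measurePreserving_inner_stdGaussian {x : EuclideanSpace ℝ (Fin d)} (hx : ‖x‖ = 1) :
    MeasurePreserving (fun w => ⟪w, x⟫) (stdGaussian (EuclideanSpace ℝ (Fin d)))
      (gaussianReal 0 1) := by
  refine ⟨by fun_prop, ?_⟩
  have h := IsGaussian.map_eq_gaussianReal (μ := stdGaussian (EuclideanSpace ℝ (Fin d)))
    (innerSL ℝ x)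
  rw [integral_strongDual_stdGaussian, variance_dual_stdGaussian, innerSL_apply_norm, hx] at h
  simp only [one_pow, Real.toNNReal_one] at h
  rw [← h]
  congr 1
  ext w
  simp [real_inner_comm]

/-- The density is at most `1/√(2π) ≤ 1/2` and the interval has length `2R`. -/
theorem gaussianReal_abs_le_le {R : ℝ} (hR : 0 ≤ R) :
    (gaussianReal 0 1).real {z | |z| ≤ R} ≤ R := by
  have hset : {z : ℝ | |z| ≤ R} = Set.Icc (-R) R := by
    ext z
    simp [abs_le]
  have hpdf : ∀ z, gaussianPDF 0 1 z ≤ ENNReal.ofReal (1 / 2) := by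
    intro z
    refine ENNReal.ofReal_le_ofReal ?_
    have h1 : (2 : ℝ) ≤ Real.sqrt (2 * Real.pi * (1 : NNReal)) := by
      refine Real.le_sqrt_of_sq_le ?_
      push_cast
      nlinarith [Real.pi_gt_three]
    have h2 : Real.exp (-(z - 0) ^ 2 / (2 * (1 : NNReal))) ≤ 1 := by
      rw [Real.exp_le_one_iff]
      push_cast
      nlinarith [sq_nonneg (z - 0)]
    rw [gaussianPDFReal, one_div]
    calc _ ≤ (Real.sqrt (2 * Real.pi * (1 : NNReal)))⁻¹ * 1 := by gcongr
      _ ≤ _ := by rw [mul_one]; gcongr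
  rw [measureReal_def, gaussianReal_apply 0 one_ne_zero, hset]
  refine ENNReal.toReal_le_of_le_ofReal hR ?_
  calc _ ≤ ∫⁻ _ in Set.Icc (-R) R, ENNReal.ofReal (1 / 2) := lintegral_mono fun z => hpdf z
    _ = ENNReal.ofReal R := by
      rw [setLIntegral_const, Real.volume_Icc, ← ENNReal.ofReal_mul (by norm_num)]
      congr 1
      ring

/-- Chernoff's bound on each tail, with the optimal parameters `M` and `-M`. -/
theorem gaussianReal_le_abs_le {M : ℝ} (hM : 0 ≤ M) :
    (gaussianReal 0 1).real {z | M ≤ |z|} ≤ 2 * Real.exp (-(M ^ 2 / 2)) := by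
  have hset : {z : ℝ | M ≤ |z|} = {z | M ≤ id z} ∪ {z | id z ≤ -M} := by
    ext z
    simp [le_abs, le_neg]
  have h1 := measure_ge_le_exp_mul_mgf (μ := gaussianReal 0 1) (X := id) M hM
    (integrable_exp_mul_gaussianReal M)
  have h2 := measure_le_le_exp_mul_mgf (μ := gaussianReal 0 1) (X := id) (-M) (neg_nonpos.2 hM)
    (integrable_exp_mul_gaussianReal (-M))
  rw [mgf_id_gaussianReal, ← Real.exp_add] at h1 h2
  rw [hset]
  refine (measureReal_union_le _ _).trans ((add_le_add h1 h2).trans (le_of_eq ?_))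
  push_cast
  ring_nf

theorem integral_sq_gaussianReal : ∫ z, z ^ 2 ∂(gaussianReal 0 1) = 1 := by
  have h := variance_of_integral_eq_zero (μ := gaussianReal 0 1) (X := fun z => z)
    measurable_id.aemeasurable integral_id_gaussianReal
  rw [variance_fun_id_gaussianReal] at h
  exact_mod_cast h.symm

instance isProbabilityMeasure_rademacher :
    IsProbabilityMeasure (uniformOn ({-1, 1} : Set ℝ)) :=
  isProbabilityMeasure_uniformOn (by simp) (by simp)

theorem ae_mem_rademacher : ∀ᵐ z ∂(uniformOn ({-1, 1} : Set ℝ)), z ∈ ({-1, 1} : Set ℝ) := by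
  have h : uniformOn ({-1, 1} : Set ℝ) {-1, 1} = 1 := uniformOn_self (by simp) (by simp)
  rwa [← prob_compl_eq_zero_iff (Set.Finite.measurableSet (by simp))] at h

theorem ae_abs_rademacher : ∀ᵐ z ∂(uniformOn ({-1, 1} : Set ℝ)), |z| = 1 := by
  filter_upwards [ae_mem_rademacher] with z hz
  rcases hz with rfl | rfl <;> simp

theorem rademacher_singleton {z : ℝ} (hz : z ∈ ({-1, 1} : Finset ℝ)) :
    (uniformOn ({-1, 1} : Set ℝ)).real {z} = 1 / 2 := by
  have h := uniformOn_apply_finset (s := ({-1, 1} : Finset ℝ)) (t := {z})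
  rw [Finset.inter_singleton_of_mem hz, Finset.card_singleton, Finset.card_pair (by norm_num)] at h
  push_cast at h
  rw [measureReal_def, h]
  simp

theorem integral_rademacher : ∫ z, z ∂(uniformOn ({-1, 1} : Set ℝ)) = 0 := by
  rw [← Measure.restrict_eq_self_of_ae_mem ae_mem_rademacher]
  have h := setIntegral_finset (μ := uniformOn ({-1, 1} : Set ℝ)) (f := fun z : ℝ => z)
    ({-1, 1} : Finset ℝ) IntegrableOn.finset
  push_cast at h
  rw [h, Finset.sum_congr rfl fun z hz => by rw [rademacher_singleton hz],
    Finset.sum_pair (by norm_num)]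
  norm_num

/-! ### Concentration of empirical means -/

/-- Chebyshev's inequality; an exponential bound is not needed, as the width already grows
polynomially in `1/δ`. -/
theorem pi_abs_mean_sub_le {Ω : Type*} [MeasurableSpace Ω] (μ : Measure Ω)
    [IsProbabilityMeasure μ] {f : Ω → ℝ} (hf : Measurable f) (hf1 : ∀ w, |f w| ≤ 1)
    (hm : 0 < m) {ε : ℝ} (hε : 0 < ε) :
    (Measure.pi fun _ : Fin m => μ).real {W | ε ≤ |1 / m * ∑ r, f (W r) - ∫ w, f w ∂μ|} ≤
      1 / (m * ε ^ 2) := by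
  have hm' : (0 : ℝ) < m := by exact_mod_cast hm
  have hmem : MemLp f 2 μ :=
    MemLp.of_bound hf.aestronglyMeasurable 1 (Filter.Eventually.of_forall hf1)
  set X : (Fin m → Ω) → ℝ := fun W => 1 / m * ∑ r, f (W r) with hX
  have hXm : Measurable X := by fun_prop
  have hXmem : MemLp X 2 (Measure.pi fun _ : Fin m => μ) := by
    refine MemLp.of_bound hXm.aestronglyMeasurable 1 (Filter.Eventually.of_forall fun W => ?_)
    rw [hX, Real.norm_eq_abs, abs_mul, abs_of_pos (by positivity), one_div,
      inv_mul_le_iff₀ hm', mul_one]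
    refine (Finset.abs_sum_le_sum_abs _ _).trans ?_
    simpa using Finset.sum_le_sum fun r (_ : r ∈ Finset.univ) => hf1 (W r)
  have hint : ∫ W, X W ∂(Measure.pi fun _ : Fin m => μ) = ∫ w, f w ∂μ := by
    rw [hX, integral_const_mul, integral_finsetSum]
    · have : ∀ r : Fin m, ∫ W, f (W r) ∂(Measure.pi fun _ : Fin m => μ) = ∫ w, f w ∂μ := fun r =>
        integral_comp_eval (μ := fun _ : Fin m => μ) hf.aestronglyMeasurable
      simp only [this, Finset.sum_const, Finset.card_univ, Fintype.card_fin, nsmul_eq_mul]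
      field_simp
    · intro r _
      exact integrable_comp_eval (μ := fun _ : Fin m => μ) (hmem.integrable one_le_two)
  have hvar : Var[X; Measure.pi fun _ : Fin m => μ] ≤ 1 / m := by
    have h1 := variance_sum_pi (μ := fun _ : Fin m => μ) (X := fun _ => f) fun _ => hmem
    have h2 : Var[f; μ] ≤ 1 := by
      refine (variance_le_expectation_sq hf.aestronglyMeasurable).trans ?_
      refine (integral_mono hmem.integrable_sq (integrable_const 1) fun w => ?_).trans (by simp)
      exact (sq_le_one_iff_abs_le_one _).2 (hf1 w)
    have h3 : X = fun W => 1 / m * (∑ r, fun W : Fin m → Ω => f (W r)) W := by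
      ext W
      simp [hX]
    rw [h3, variance_const_mul, h1, Finset.sum_const, Finset.card_univ, Fintype.card_fin,
      nsmul_eq_mul]
    calc _ = 1 / m * Var[f; μ] := by field_simp
      _ ≤ 1 / m * 1 := by gcongr
      _ = _ := mul_one _
  have h := meas_ge_le_variance_div_sq hXmem hε
  rw [hint] at h
  refine (ENNReal.toReal_le_of_le_ofReal
    (div_nonneg (variance_nonneg _ _) (sq_nonneg _)) h).trans ?_
  calc _ ≤ 1 / m / ε ^ 2 := by gcongr
    _ = _ := by rw [div_div]

/-! ### The smallest eigenvalue -/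

/-- Subtracting `lambdaMin A` times the identity shifts the spectrum into the nonnegative reals, so
the difference is positive semidefinite. -/
theorem lambdaMin_mul_norm_sq_le {A : Matrix (Fin n) (Fin n) ℝ} (hA : A.IsHermitian)
    (v : EuclideanSpace ℝ (Fin n)) :
    lambdaMin A * ‖v‖ ^ 2 ≤ ∑ i, ∑ j, v i * v j * A i j := by
  have hps : (A - algebraMap ℝ (Matrix (Fin n) (Fin n) ℝ) (lambdaMin A)).PosSemidef := by
    rw [Matrix.posSemidef_iff_isHermitian_and_spectrum_nonneg]
    refine ⟨hA.sub ?_, ?_⟩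
    · rw [Matrix.algebraMap_eq_diagonal]
      exact Matrix.isHermitian_diagonal _
    · rw [← spectrum.sub_singleton_eq]
      rintro _ ⟨b, hb, c, rfl, rfl⟩
      exact sub_nonneg.2 (csInf_le Matrix.finite_real_spectrum.bddBelow hb)
  have h := hps.dotProduct_mulVec_nonneg v.ofLp
  rw [Matrix.sub_mulVec, Algebra.algebraMap_eq_smul_one, Matrix.smul_mulVec, Matrix.one_mulVec,
    dotProduct_sub, dotProduct_smul, sub_nonneg] at h
  rw [EuclideanSpace.real_norm_sq_eq]
  simp only [dotProduct, Matrix.mulVec, Finset.mul_sum, smul_eq_mul, star_trivial] at h ⊢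
  refine (le_of_eq ?_).trans (h.trans (le_of_eq ?_))
  · exact Finset.sum_congr rfl fun i _ => by ring
  · exact Finset.sum_congr rfl fun i _ => Finset.sum_congr rfl fun j _ => by ring

/-! ### The random initialization -/

@[fun_prop]
theorem measurable_step : Measurable step :=
  Measurable.ite measurableSet_Ici measurable_const measurable_const

theorem measurable_nearZero (R : ℝ) : Measurable (nearZero R) :=
  Measurable.ite (measurableSet_le (by fun_prop) measurable_const) measurable_const measurable_const

@[fun_prop]
theorem measurable_relu : Measurable relu := lipschitzWith_relu.continuous.measurable

/-- The law of the first layer at initialization. -/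
noncomputable def weightLaw (m d : ℕ) : Measure (Fin m → EuclideanSpace ℝ (Fin d)) :=
  Measure.pi fun _ => stdGaussian (EuclideanSpace ℝ (Fin d))

/-- The law of the second layer at initialization. -/
noncomputable def signLaw (m : ℕ) : Measure (Fin m → ℝ) :=
  Measure.pi fun _ => uniformOn ({-1, 1} : Set ℝ)

instance : IsProbabilityMeasure (weightLaw m d) := by unfold weightLaw; infer_instance

instance : IsProbabilityMeasure (signLaw m) := by unfold signLaw; infer_instance

theorem initLaw_eq_prod : initLaw m d = (weightLaw m d).prod (signLaw m) := rfl

instance : IsProbabilityMeasure (initLaw m d) := by rw [initLaw_eq_prod]; infer_instance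

theorem measurePreserving_preactivation {x : EuclideanSpace ℝ (Fin d)} (hx : ‖x‖ = 1) (r : Fin m) :
    MeasurePreserving (fun W => ⟪W r, x⟫) (weightLaw m d) (gaussianReal 0 1) :=
  (measurePreserving_inner_stdGaussian hx).comp
    (measurePreserving_eval (fun _ : Fin m => stdGaussian (EuclideanSpace ℝ (Fin d))) r)

/-- The random variable whose expectation is the `(i, j)` entry of the Gram matrix. -/
noncomputable def gramKernel (x : Fin n → EuclideanSpace ℝ (Fin d)) (i j : Fin n)
    (w : EuclideanSpace ℝ (Fin d)) : ℝ :=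
  ⟪x i, x j⟫ * (step ⟪w, x i⟫ * step ⟪w, x j⟫)

theorem measurable_gramKernel (x : Fin n → EuclideanSpace ℝ (Fin d)) (i j : Fin n) :
    Measurable (gramKernel x i j) := by
  unfold gramKernel
  exact measurable_const.mul ((measurable_step.comp (by fun_prop)).mul
    (measurable_step.comp (by fun_prop)))

theorem abs_gramKernel_le {x : Fin n → EuclideanSpace ℝ (Fin d)} (hx : ∀ i, ‖x i‖ = 1)
    (i j : Fin n) (w : EuclideanSpace ℝ (Fin d)) : |gramKernel x i j w| ≤ 1 := by
  have h := abs_real_inner_le_norm (x i) (x j)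
  rw [hx, hx, one_mul] at h
  unfold gramKernel
  rw [abs_mul, abs_mul]
  exact mul_le_one₀ h (by positivity)
    (mul_le_one₀ (abs_step_le _) (abs_nonneg _) (abs_step_le _))

theorem gramInf_apply (x : Fin n → EuclideanSpace ℝ (Fin d)) (i j : Fin n) :
    gramInf x i j = ∫ w, gramKernel x i j w ∂(stdGaussian (EuclideanSpace ℝ (Fin d))) := by
  unfold gramInf gramKernel step
  rw [Matrix.of_apply]
  refine integral_congr_ae (Filter.Eventually.of_forall fun w => ?_)
  by_cases h1 : 0 ≤ ⟪w, x i⟫ <;> by_cases h2 : 0 ≤ ⟪w, x j⟫ <;> simp [h1, h2]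

theorem isHermitian_gramInf (x : Fin n → EuclideanSpace ℝ (Fin d)) : (gramInf x).IsHermitian := by
  ext i j
  rw [Matrix.conjTranspose_apply, star_trivial, gramInf_apply, gramInf_apply]
  simp only [gramKernel, real_inner_comm (x i) (x j), mul_comm (step ⟪_, x i⟫)]

/-- The Rayleigh quotient at a basis vector is a diagonal entry. The bound allows powers of `λ₀` to
be discarded in `width_bounds`. -/
theorem lambdaMin_gramInf_le_one {x : Fin n → EuclideanSpace ℝ (Fin d)} (hx : ∀ i, ‖x i‖ = 1)
    (hn : 0 < n) : lambdaMin (gramInf x) ≤ 1 := by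
  have h := lambdaMin_mul_norm_sq_le (isHermitian_gramInf x)
    (EuclideanSpace.single (⟨0, hn⟩ : Fin n) (1 : ℝ))
  rw [PiLp.norm_single, norm_one, one_pow, mul_one] at h
  refine h.trans ?_
  simp only [PiLp.single_apply, ite_mul, one_mul, zero_mul, mul_ite, mul_zero, mul_one,
    Finset.sum_ite_eq', Finset.mem_univ, if_true]
  rw [gramInf_apply]
  refine (integral_mono (MemLp.of_bound (p := 1) (measurable_gramKernel x _ _).aestronglyMeasurable 1
    (Filter.Eventually.of_forall (abs_gramKernel_le hx _ _)) |>.integrable le_rfl)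
    (integrable_const 1) fun w => (le_abs_self _).trans (abs_gramKernel_le hx _ _ w)).trans ?_
  simp

/-- Entrywise errors of size `ε` change the quadratic form by at most `n ε ‖v‖²` (Cauchy–Schwarz in
each index), which is `λ/8 ‖v‖²` here. -/
theorem gram_lower_bound {x : Fin n → EuclideanSpace ℝ (Fin d)} (hn : 0 < n)
    {W : Fin m → EuclideanSpace ℝ (Fin d)}
    (h : ∀ i j, |1 / m * ∑ r, gramKernel x i j (W r) - gramInf x i j| ≤
      lambdaMin (gramInf x) / (8 * n)) (v : EuclideanSpace ℝ (Fin n)) :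
    7 / 8 * lambdaMin (gramInf x) * ‖v‖ ^ 2 ≤
      1 / m * ∑ r, ‖∑ i, (v i * step ⟪W r, x i⟫) • x i‖ ^ 2 := by
  have hn' : (0 : ℝ) < n := by exact_mod_cast hn
  set lam := lambdaMin (gramInf x) with hlam
  have hlam0 : 0 ≤ lam := by
    have h1 := (abs_nonneg _).trans (h ⟨0, hn⟩ ⟨0, hn⟩)
    rwa [le_div_iff₀ (by positivity), zero_mul] at h1
  have hexp : ∀ r, ‖∑ i, (v i * step ⟪W r, x i⟫) • x i‖ ^ 2 =
      ∑ i, ∑ j, v i * v j * gramKernel x i j (W r) := by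
    intro r
    rw [← real_inner_self_eq_norm_sq, sum_inner]
    refine Finset.sum_congr rfl fun i _ => ?_
    rw [inner_sum]
    refine Finset.sum_congr rfl fun j _ => ?_
    rw [inner_smul_left, inner_smul_right, gramKernel, conj_trivial]
    ring
  have heq : 1 / m * ∑ r, ‖∑ i, (v i * step ⟪W r, x i⟫) • x i‖ ^ 2 =
      ∑ i, ∑ j, v i * v j * (1 / m * ∑ r, gramKernel x i j (W r)) := by
    simp only [hexp]
    rw [Finset.sum_comm, Finset.mul_sum]
    refine Finset.sum_congr rfl fun i _ => ?_
    rw [Finset.sum_comm, Finset.mul_sum]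
    refine Finset.sum_congr rfl fun j _ => ?_
    rw [← Finset.mul_sum]
    ring
  have hinf := lambdaMin_mul_norm_sq_le (isHermitian_gramInf x) v
  rw [← hlam] at hinf
  have hdiff : ∑ i, ∑ j, v i * v j * gramInf x i j -
      ∑ i, ∑ j, v i * v j * (1 / m * ∑ r, gramKernel x i j (W r)) ≤ lam / 8 * ‖v‖ ^ 2 := by
    rw [← Finset.sum_sub_distrib]
    simp only [← Finset.sum_sub_distrib, ← mul_sub]
    have h1 : ∀ i, |∑ j, v j * (gramInf x i j - 1 / m * ∑ r, gramKernel x i j (W r))| ≤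
        Real.sqrt n * ‖v‖ * (lam / (8 * n)) := fun i =>
      (Finset.abs_sum_le_sum_abs _ _).trans (abs_sum_mul_le v fun j => by
        rw [abs_sub_comm]
        exact h i j)
    calc _ = ∑ i, v i * ∑ j, v j * (gramInf x i j - 1 / m * ∑ r, gramKernel x i j (W r)) := by
          simp only [Finset.mul_sum, mul_assoc]
      _ ≤ _ := (Finset.sum_le_sum fun i _ => le_abs_self _).trans (abs_sum_mul_le v h1)
      _ = (Real.sqrt n) ^ 2 * ‖v‖ ^ 2 * (lam / (8 * n)) := by ring
      _ = _ := by
          rw [Real.sq_sqrt hn'.le]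
          field_simp
  rw [heq]
  linarith

theorem weightLaw_gram_le {x : Fin n → EuclideanSpace ℝ (Fin d)} (hx : ∀ i, ‖x i‖ = 1)
    (hm : 0 < m) {ε : ℝ} (hε : 0 < ε) :
    (weightLaw m d).real
      {W | ∃ i j, ε ≤ |1 / m * ∑ r, gramKernel x i j (W r) - gramInf x i j|} ≤
      n ^ 2 / (m * ε ^ 2) := by
  have hset : {W : Fin m → EuclideanSpace ℝ (Fin d) |
      ∃ i j, ε ≤ |1 / m * ∑ r, gramKernel x i j (W r) - gramInf x i j|} =
      ⋃ p : Fin n × Fin n,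
        {W | ε ≤ |1 / m * ∑ r, gramKernel x p.1 p.2 (W r) - gramInf x p.1 p.2|} := by
    ext W
    simp
  rw [hset]
  refine (measureReal_iUnion_fintype_le _).trans
    ((Finset.sum_le_sum (g := fun _ => 1 / (m * ε ^ 2)) fun p _ => ?_).trans (le_of_eq ?_))
  · rw [gramInf_apply]
    exact pi_abs_mean_sub_le _ (measurable_gramKernel x p.1 p.2) (abs_gramKernel_le hx p.1 p.2)
      hm hε
  · simp
    ring

/-- Markov's inequality: each of the `m n` preactivations is standard Gaussian, hence within `R` of
zero with probability at most `R`. -/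
theorem weightLaw_margin_le {x : Fin n → EuclideanSpace ℝ (Fin d)} (hx : ∀ i, ‖x i‖ = 1)
    {R : ℝ} (hR : 0 ≤ R) (θ : ℝ) :
    θ * (weightLaw m d).real {W | θ ≤ ∑ r, ∑ i, nearZero R ⟪W r, x i⟫} ≤ m * n * R := by
  have hms : MeasurableSet {z : ℝ | |z| ≤ R} := measurableSet_le (by fun_prop) measurable_const
  have hnear : ∀ z, nearZero R z = {z : ℝ | |z| ≤ R}.indicator (fun _ => 1) z := fun z => by
    simp [nearZero, Set.indicator]
  have hint0 : Integrable (nearZero R) (gaussianReal 0 1) := by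
    rw [show nearZero R = _ from funext hnear]
    exact (integrable_const 1).indicator hms
  have hint : ∀ (r : Fin m) i, Integrable (fun W => nearZero R ⟪W r, x i⟫) (weightLaw m d) :=
    fun r i => (measurePreserving_preactivation (hx i) r).integrable_comp_of_integrable hint0
  have hval : ∀ (r : Fin m) i, ∫ W, nearZero R ⟪W r, x i⟫ ∂(weightLaw m d) ≤ R := by
    intro r i
    have h1 := integral_map (μ := weightLaw m d)
      (measurePreserving_preactivation (m := m) (hx i) r).measurable.aemeasurable
      (measurable_nearZero R).aestronglyMeasurable
    rw [← h1, (measurePreserving_preactivation (m := m) (hx i) r).map_eq]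
    simp only [hnear]
    rw [integral_indicator_const _ hms, smul_eq_mul, mul_one]
    exact gaussianReal_abs_le_le hR
  refine (mul_meas_ge_le_integral_of_nonneg (Filter.Eventually.of_forall fun W =>
    Finset.sum_nonneg fun r _ => Finset.sum_nonneg fun i _ => nearZero_nonneg _ _)
    (integrable_finsetSum _ fun r _ => integrable_finsetSum _ fun i _ => hint r i) θ).trans ?_
  rw [integral_finsetSum _ fun r _ => integrable_finsetSum _ fun i _ => hint r i]
  calc _ ≤ ∑ r : Fin m, ∑ i : Fin n, R := by
        refine Finset.sum_le_sum fun r _ => ?_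
        rw [integral_finsetSum _ fun i _ => hint r i]
        exact Finset.sum_le_sum fun i _ => hval r i
    _ = _ := by simp [mul_assoc]

theorem weightLaw_bound_le {x : Fin n → EuclideanSpace ℝ (Fin d)} (hx : ∀ i, ‖x i‖ = 1)
    {M : ℝ} (hM : 0 ≤ M) :
    (weightLaw m d).real {W | ∃ r i, M ≤ |⟪W r, x i⟫|} ≤
      m * n * (2 * Real.exp (-(M ^ 2 / 2))) := by
  have hset : {W : Fin m → EuclideanSpace ℝ (Fin d) | ∃ r i, M ≤ |⟪W r, x i⟫|} =
      ⋃ p : Fin m × Fin n, (fun W => ⟪W p.1, x p.2⟫) ⁻¹' {z | M ≤ |z|} := by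
    ext W
    simp
  rw [hset]
  refine (measureReal_iUnion_fintype_le _).trans
    ((Finset.sum_le_sum (g := fun _ => 2 * Real.exp (-(M ^ 2 / 2))) fun p _ => ?_).trans
      (le_of_eq ?_))
  · rw [(measurePreserving_preactivation (hx p.2) p.1).measureReal_preimage
      (measurableSet_le measurable_const (by fun_prop)).nullMeasurableSet]
    exact gaussianReal_le_abs_le hM
  · simp [mul_assoc]

/-- For fixed `W` the output is a sum of independent centred terms, so cross terms vanish and the
variances add up. With `lintegral`, integrating over `W` afterwards needs no integrability on the
product. -/
theorem lintegral_net_signLaw_le (W : Fin m → EuclideanSpace ℝ (Fin d))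
    (x : EuclideanSpace ℝ (Fin d)) :
    ∫⁻ a, ENNReal.ofReal (net W a x ^ 2) ∂(signLaw m) ≤
      ENNReal.ofReal (1 / m * ∑ r, ⟪W r, x⟫ ^ 2) := by
  set X : Fin m → ℝ → ℝ := fun r z => 1 / Real.sqrt m * relu ⟪W r, x⟫ * z with hX
  have hmem : ∀ r, MemLp (X r) 2 (uniformOn ({-1, 1} : Set ℝ)) := fun r =>
    (MemLp.of_bound measurable_id.aestronglyMeasurable 1
      (ae_abs_rademacher.mono fun z hz => hz.le)).const_mul _
  have hmean : ∀ r, ∫ z, X r z ∂(uniformOn ({-1, 1} : Set ℝ)) = 0 := fun r => by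
    simp only [hX]
    rw [integral_const_mul, integral_rademacher, mul_zero]
  have hnet : (fun a => net W a x) = ∑ r, fun a : Fin m → ℝ => X r (a r) := by
    ext a
    rw [Finset.sum_apply, net, Finset.mul_sum]
    exact Finset.sum_congr rfl fun r _ => by simp only [hX]; ring
  have hmemr : ∀ r, MemLp (fun a : Fin m → ℝ => X r (a r)) 2 (signLaw m) := fun r =>
    (hmem r).comp_measurePreserving
      (measurePreserving_eval (fun _ : Fin m => uniformOn ({-1, 1} : Set ℝ)) r)
  have hmemnet : MemLp (fun a => net W a x) 2 (signLaw m) := by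
    rw [hnet]
    exact memLp_finsetSum' _ fun r _ => hmemr r
  have hzero : ∫ a, net W a x ∂(signLaw m) = 0 := by
    rw [hnet, Finset.sum_fn, integral_finsetSum _ fun r _ => (hmemr r).integrable one_le_two]
    refine Finset.sum_eq_zero fun r _ => ?_
    rw [← hmean r]
    exact integral_comp_eval (μ := fun _ : Fin m => uniformOn ({-1, 1} : Set ℝ))
      (hmem r).aestronglyMeasurable
  rw [← ofReal_integral_eq_lintegral_ofReal hmemnet.integrable_sq
    (Filter.Eventually.of_forall fun a => sq_nonneg _)]
  refine ENNReal.ofReal_le_ofReal ?_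
  rw [← variance_of_integral_eq_zero hmemnet.aestronglyMeasurable.aemeasurable hzero, hnet, signLaw,
    variance_sum_pi hmem, Finset.mul_sum]
  refine Finset.sum_le_sum fun r _ => ?_
  rw [variance_of_integral_eq_zero (hmem r).aestronglyMeasurable.aemeasurable (hmean r)]
  have hae : (fun z => X r z ^ 2) =ᵐ[uniformOn ({-1, 1} : Set ℝ)]
      fun _ => 1 / m * relu ⟪W r, x⟫ ^ 2 := by
    filter_upwards [ae_abs_rademacher] with z hz
    simp only [hX]
    rw [mul_pow, mul_pow, ← sq_abs z, hz, div_pow, Real.sq_sqrt (Nat.cast_nonneg m)]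
    ring
  rw [integral_congr_ae hae, integral_const]
  simp only [probReal_univ, one_smul]
  exact mul_le_mul_of_nonneg_left (sq_le_sq.2 (abs_relu_le _)) (by positivity)

@[fun_prop]
theorem measurable_net (x : EuclideanSpace ℝ (Fin d)) :
    Measurable fun p : (Fin m → EuclideanSpace ℝ (Fin d)) × (Fin m → ℝ) => net p.1 p.2 x := by
  unfold net
  refine measurable_const.mul (Finset.measurable_fun_sum _ fun r _ => ?_)
  exact (by fun_prop : Measurable fun p : (Fin m → EuclideanSpace ℝ (Fin d)) × (Fin m → ℝ) =>
    p.2 r).mul (measurable_relu.comp (by fun_prop))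

theorem lintegral_net_le_one {x : EuclideanSpace ℝ (Fin d)} (hx : ‖x‖ = 1) :
    ∫⁻ p, ENNReal.ofReal (net p.1 p.2 x ^ 2) ∂(initLaw m d) ≤ 1 := by
  rw [initLaw_eq_prod, lintegral_prod _ (by fun_prop)]
  refine (lintegral_mono fun W => lintegral_net_signLaw_le W x).trans ?_
  have hsq : Integrable (fun z : ℝ => z ^ 2) (gaussianReal 0 1) :=
    IsGaussian.memLp_two_id.integrable_sq
  have hint : ∀ r : Fin m, Integrable (fun W => ⟪W r, x⟫ ^ 2) (weightLaw m d) := fun r =>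
    (measurePreserving_preactivation hx r).integrable_comp_of_integrable hsq
  have hval : ∀ r : Fin m, ∫ W, ⟪W r, x⟫ ^ 2 ∂(weightLaw m d) = 1 := by
    intro r
    have h1 := integral_map (μ := weightLaw m d) (f := fun z : ℝ => z ^ 2)
      (measurePreserving_preactivation (m := m) hx r).measurable.aemeasurable
      (by fun_prop)
    rw [← h1, (measurePreserving_preactivation (m := m) hx r).map_eq, integral_sq_gaussianReal]
  rw [← ofReal_integral_eq_lintegral_ofReal
    ((integrable_finsetSum _ fun r _ => hint r).const_mul _)
    (Filter.Eventually.of_forall fun W => by positivity), integral_const_mul,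
    integral_finsetSum _ fun r _ => hint r, ENNReal.ofReal_le_one]
  simp only [hval, Finset.sum_const, Finset.card_univ, Fintype.card_fin, nsmul_eq_mul, mul_one]
  rw [one_div]
  exact inv_mul_le_one

theorem initLaw_output_le {x : Fin n → EuclideanSpace ℝ (Fin d)} (hx : ∀ i, ‖x i‖ = 1)
    {θ : ℝ} (hθ : 0 < θ) :
    (initLaw m d).real {p | θ ≤ ∑ i, net p.1 p.2 (x i) ^ 2} ≤ n / θ := by
  have h := mul_meas_ge_le_lintegral (μ := initLaw m d)
    (f := fun p => ENNReal.ofReal (∑ i, net p.1 p.2 (x i) ^ 2)) (by fun_prop) (ENNReal.ofReal θ)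
  have hle : ∫⁻ p, ENNReal.ofReal (∑ i, net p.1 p.2 (x i) ^ 2) ∂(initLaw m d) ≤
      ENNReal.ofReal n := by
    simp only [ENNReal.ofReal_sum_of_nonneg fun i (_ : i ∈ Finset.univ) => sq_nonneg _]
    rw [lintegral_finsetSum _ fun i _ => by fun_prop]
    refine (Finset.sum_le_sum fun i _ => lintegral_net_le_one (hx i)).trans ?_
    simp
  have hset : {p : (Fin m → EuclideanSpace ℝ (Fin d)) × (Fin m → ℝ) |
      ENNReal.ofReal θ ≤ ENNReal.ofReal (∑ i, net p.1 p.2 (x i) ^ 2)} =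
      {p | θ ≤ ∑ i, net p.1 p.2 (x i) ^ 2} := by
    ext p
    exact ENNReal.ofReal_le_ofReal_iff (by positivity)
  rw [hset] at h
  have h2 := ENNReal.toReal_mono ENNReal.ofReal_ne_top (h.trans hle)
  rw [ENNReal.toReal_mul, ENNReal.toReal_ofReal hθ.le, ENNReal.toReal_ofReal (Nat.cast_nonneg n)]
    at h2
  rw [le_div_iff₀ hθ, mul_comm]
  exact h2

theorem initLaw_sign : (initLaw m d).real {p | ∃ r, ¬|p.2 r| = 1} = 0 := by
  have h : ∀ᵐ a ∂(signLaw m), ∀ r, |a r| = 1 := ae_all_iff.2 fun r =>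
    (measurePreserving_eval (fun _ : Fin m => uniformOn ({-1, 1} : Set ℝ)) r).quasiMeasurePreserving.ae
      ae_abs_rademacher
  have h2 : ∀ᵐ p ∂(initLaw m d), ∀ r, |p.2 r| = 1 :=
    (measurePreserving_snd (μ := weightLaw m d) (ν := signLaw m)).quasiMeasurePreserving.ae h
  rw [measureReal_def, ENNReal.toReal_eq_zero_iff]
  left
  simpa [ae_iff] using h2

/-! ### The probability of a good initialization -/

/-- The initializations excluded from the convergence theorem: the Gram matrix deviates by `ε` from
its expectation, or `θ` preactivations are `R`-close to the kink, or some preactivation exceeds `M`,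
or the squared norm of the output exceeds `S`, or some sign is not `±1`. -/
def badInit (x : Fin n → EuclideanSpace ℝ (Fin d)) (m : ℕ) (ε θ R M S : ℝ) :
    Set ((Fin m → EuclideanSpace ℝ (Fin d)) × (Fin m → ℝ)) :=
  Prod.fst ⁻¹' {W | ∃ i j, ε ≤ |1 / m * ∑ r, gramKernel x i j (W r) - gramInf x i j|} ∪
    (Prod.fst ⁻¹' {W | θ ≤ ∑ r, ∑ i, nearZero R ⟪W r, x i⟫} ∪
      (Prod.fst ⁻¹' {W | ∃ r i, M ≤ |⟪W r, x i⟫|} ∪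
        ({p | S ≤ ∑ i, net p.1 p.2 (x i) ^ 2} ∪ {p | ∃ r, ¬|p.2 r| = 1})))

theorem measurableSet_gram_deviation (x : Fin n → EuclideanSpace ℝ (Fin d)) (m : ℕ) (ε : ℝ) :
    MeasurableSet {W : Fin m → EuclideanSpace ℝ (Fin d) |
      ∃ i j, ε ≤ |1 / m * ∑ r, gramKernel x i j (W r) - gramInf x i j|} := by
  simp only [measurableSet_setOfPred]
  refine Measurable.exists fun i => Measurable.exists fun j => measurableSet_setOfPred.1 ?_
  have h := measurable_gramKernel x i j
  exact measurableSet_le measurable_const (by fun_prop)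

theorem measurableSet_margin (x : Fin n → EuclideanSpace ℝ (Fin d)) (m : ℕ) (θ R : ℝ) :
    MeasurableSet {W : Fin m → EuclideanSpace ℝ (Fin d) |
      θ ≤ ∑ r, ∑ i, nearZero R ⟪W r, x i⟫} := by
  refine measurableSet_le measurable_const (Finset.measurable_fun_sum _ fun r _ =>
    Finset.measurable_fun_sum _ fun i _ => (measurable_nearZero R).comp (by fun_prop))

theorem measurableSet_bound (x : Fin n → EuclideanSpace ℝ (Fin d)) (m : ℕ) (M : ℝ) :
    MeasurableSet {W : Fin m → EuclideanSpace ℝ (Fin d) | ∃ r i, M ≤ |⟪W r, x i⟫|} := by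
  simp only [measurableSet_setOfPred]
  exact Measurable.exists fun r => Measurable.exists fun i =>
    measurableSet_setOfPred.1 (measurableSet_le measurable_const (by fun_prop))

theorem measurableSet_badInit (x : Fin n → EuclideanSpace ℝ (Fin d)) (m : ℕ) (ε θ R M S : ℝ) :
    MeasurableSet (badInit x m ε θ R M S) := by
  refine (measurable_fst (measurableSet_gram_deviation x m ε)).union
    ((measurable_fst (measurableSet_margin x m θ R)).union
      ((measurable_fst (measurableSet_bound x m M)).union (MeasurableSet.union ?_ ?_)))
  · exact measurableSet_le measurable_const (by fun_prop)
  · simp only [measurableSet_setOfPred]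
    exact Measurable.exists fun r =>
      measurableSet_setOfPred.1 (measurableSet_eq_fun (by fun_prop) measurable_const).compl

/-- Union bound over the five events, the last of which is null. -/
theorem initLaw_badInit_le {x : Fin n → EuclideanSpace ℝ (Fin d)} (hx : ∀ i, ‖x i‖ = 1)
    (hm : 0 < m) {ε θ R M S : ℝ} (hε : 0 < ε) (hθ : 0 < θ) (hR : 0 ≤ R) (hM : 0 ≤ M)
    (hS : 0 < S) :
    (initLaw m d).real (badInit x m ε θ R M S) ≤
      n ^ 2 / (m * ε ^ 2) + (m * n * R / θ + (m * n * (2 * Real.exp (-(M ^ 2 / 2))) + n / S)) := by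
  have hfst : ∀ {s : Set (Fin m → EuclideanSpace ℝ (Fin d))}, MeasurableSet s →
      (initLaw m d).real (Prod.fst ⁻¹' s) = (weightLaw m d).real s := fun hs =>
    (measurePreserving_fst (μ := weightLaw m d) (ν := signLaw m)).measureReal_preimage
      hs.nullMeasurableSet
  unfold badInit
  refine (measureReal_union_le _ _).trans (add_le_add ?_ ((measureReal_union_le _ _).trans
    (add_le_add ?_ ((measureReal_union_le _ _).trans (add_le_add ?_
      ((measureReal_union_le _ _).trans ?_))))))
  · rw [hfst (measurableSet_gram_deviation x m ε)]
    exact weightLaw_gram_le hx hm hε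
  · rw [hfst (measurableSet_margin x m θ R), le_div_iff₀ hθ, mul_comm]
    exact weightLaw_margin_le hx hR θ
  · rw [hfst (measurableSet_bound x m M)]
    exact weightLaw_bound_le hx hM
  · rw [initLaw_sign, add_zero]
    exact initLaw_output_le hx hS

theorem isGoodInit_of_notMem_badInit {x : Fin n → EuclideanSpace ℝ (Fin d)} (hn : 0 < n)
    {R M S : ℝ} {W : Fin m → EuclideanSpace ℝ (Fin d)} {a : Fin m → ℝ}
    (h : (W, a) ∉ badInit x m (lambdaMin (gramInf x) / (8 * n))
      (m * lambdaMin (gramInf x) / (16 * n)) R M S) :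
    IsGoodInit x (lambdaMin (gramInf x)) R M W a ∧ ∑ i, net W a (x i) ^ 2 ≤ S := by
  simp only [badInit, Set.mem_union, Set.mem_preimage, Set.mem_ofPred_eq, not_or, not_exists,
    not_le, not_not] at h
  obtain ⟨hgram, hmargin, hbound, hout, hsign⟩ := h
  exact ⟨⟨hsign, gram_lower_bound hn fun i j => (hgram i j).le, hmargin.le,
    fun r i => (hbound r i).le⟩, hout.le⟩

theorem norm_prediction_sub_sq_le {x : Fin n → EuclideanSpace ℝ (Fin d)}
    {y : EuclideanSpace ℝ (Fin n)} {W : Fin m → EuclideanSpace ℝ (Fin d)} {a : Fin m → ℝ}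
    {C S : ℝ} (hy : ∀ i, |y i| ≤ C) (h : ∑ i, net W a (x i) ^ 2 ≤ S) :
    ‖prediction x W a - y‖ ^ 2 ≤ 2 * S + 2 * n * C ^ 2 := by
  rw [norm_prediction_sub_sq]
  calc ∑ i, (net W a (x i) - y i) ^ 2 ≤ ∑ i, (2 * net W a (x i) ^ 2 + 2 * C ^ 2) := by
        refine Finset.sum_le_sum fun i _ => ?_
        have h1 : y i ^ 2 ≤ C ^ 2 := sq_le_sq' (by linarith [(abs_le.1 (hy i)).1]) (abs_le.1 (hy i)).2
        nlinarith [sq_nonneg (net W a (x i) + y i)]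
    _ = 2 * ∑ i, net W a (x i) ^ 2 + 2 * n * C ^ 2 := by
        rw [Finset.sum_add_distrib, ← Finset.mul_sum]
        simp
        ring
    _ ≤ _ := by linarith

/-! ### Consequences of the size of the width -/

/-- The tail bound for the preactivations with `M = 3 √(log q)`, `q = m n / δ`. -/
theorem tail_le {p q δ : ℝ} (hδ : 0 < δ) (hq : 2 ≤ q) (hp : p = q * δ) :
    p * (2 * Real.exp (-((3 * Real.sqrt (Real.log q)) ^ 2 / 2))) ≤ δ / 4 := by
  have hq0 : 0 < q := by linarith
  have hlog : 0 ≤ Real.log q := Real.log_nonneg (by linarith)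
  -- The left side is `q^(-9/2)`; the exponent is rounded to an integer.
  have hexp : Real.exp (-((3 * Real.sqrt (Real.log q)) ^ 2 / 2)) ≤ (q ^ 4)⁻¹ := by
    rw [mul_pow, Real.sq_sqrt hlog, Real.exp_neg]
    refine inv_anti₀ (by positivity) ?_
    rw [← Real.exp_log (pow_pos hq0 4), Real.exp_le_exp, Real.log_pow]
    push_cast
    linarith
  have h8 : (8 : ℝ) ≤ q ^ 3 := by
    calc (8 : ℝ) = 2 ^ 3 := by norm_num
      _ ≤ q ^ 3 := by gcongr
  calc _ ≤ q * δ * (2 * (q ^ 4)⁻¹) := by rw [hp]; gcongr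
    _ = 2 * δ / q ^ 3 := by field_simp
    _ ≤ 2 * δ / 8 := by gcongr
    _ = _ := by ring

/-- The inequalities that the lower bound on the width provides. -/
theorem width_bounds {N μ lam δ B ℓ : ℝ} (hN : 1 ≤ N) (hμ : 0 < μ) (hlam : 0 < lam)
    (hlam1 : lam ≤ 1) (hδ : 0 < δ) (hδ1 : δ < 1) (hB : 8 ≤ B) (hℓ : 1 / 2 ≤ ℓ)
    (h : 2 ^ 18 * B * (N ^ 6 * ℓ / (lam ^ 4 * δ ^ 3)) ≤ μ) :
    N ≤ μ ∧ 256 * N ^ 4 ≤ μ * lam ^ 2 * δ ∧ 65536 * B * N ^ 6 < μ * lam ^ 4 * δ ^ 3 ∧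
      8192 * B * N ^ 2 * ℓ < μ * lam ^ 2 * δ := by
  have h0 : 2 ^ 18 * B * (N ^ 6 * ℓ) ≤ μ * (lam ^ 4 * δ ^ 3) := by
    rwa [← mul_div_assoc, div_le_iff₀ (by positivity)] at h
  have hlam2 : lam ^ 2 ≤ 1 := pow_le_one₀ hlam.le hlam1
  have hδ2 : δ ^ 2 ≤ 1 := pow_le_one₀ hδ.le hδ1.le
  have h1 : μ * (lam ^ 4 * δ ^ 3) ≤ μ * lam ^ 2 * δ := by
    calc μ * (lam ^ 4 * δ ^ 3) = μ * lam ^ 2 * δ * (lam ^ 2 * δ ^ 2) := by ring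
      _ ≤ μ * lam ^ 2 * δ * (1 * 1) := by gcongr
      _ = _ := by ring
  have h2 : μ * lam ^ 2 * δ ≤ μ := by
    calc μ * lam ^ 2 * δ ≤ μ * 1 * 1 := by gcongr
      _ = μ := by ring
  have hN1 : N ≤ N ^ 6 := le_self_pow₀ hN (by norm_num)
  have hN2 : N ^ 2 ≤ N ^ 6 := pow_le_pow_right₀ hN (by norm_num)
  have hN4 : N ^ 4 ≤ N ^ 6 := pow_le_pow_right₀ hN (by norm_num)
  have hN6 : 0 < N ^ 6 := by positivity
  have hB6 : 8 * N ^ 6 ≤ B * N ^ 6 := by gcongr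
  -- Dropping `ℓ ≥ 1/2` costs a factor 2, which leaves twice the required `65536 = 2^16`, whence
  -- strictness.
  have h3 : 2 ^ 17 * (B * N ^ 6) ≤ 2 ^ 18 * B * (N ^ 6 * ℓ) := by
    calc 2 ^ 17 * (B * N ^ 6) = 2 ^ 18 * (B * N ^ 6) * (1 / 2) := by ring
      _ ≤ 2 ^ 18 * (B * N ^ 6) * ℓ := by gcongr
      _ = _ := by ring
  have h4 : B * N ^ 2 * ℓ ≤ B * N ^ 6 * ℓ := by gcongr
  have h5 : 0 < B * N ^ 6 * ℓ := by positivity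
  refine ⟨by linarith, by linarith, by linarith, by linarith⟩

/-- The origin of `n^6 / (λ₀^4 δ^3)`: the square of the radius contributes `n^4 / (λ₀² δ²)`, the
squared displacement `n · n/δ / λ₀²`. -/
theorem weight_radius_lt {N μ lam δ B D : ℝ} (hN : 1 ≤ N) (hμ : 0 < μ) (hlam : 0 < lam)
    (hδ : 0 < δ) (hD : D ^ 2 ≤ B * N / δ) (h : 65536 * B * N ^ 6 < μ * lam ^ 4 * δ ^ 3) :
    4 * Real.sqrt N * D / (Real.sqrt μ * lam) < δ * lam / (64 * N ^ 2) := by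
  refine lt_of_pow_lt_pow_left₀ 2 (by positivity) ?_
  rw [div_pow, div_pow, mul_pow, mul_pow, mul_pow _ lam, Real.sq_sqrt (by linarith),
    Real.sq_sqrt hμ.le, div_lt_div_iff₀ (by positivity) (by positivity)]
  have hD' : D ^ 2 * δ ≤ B * N := by rwa [le_div_iff₀ hδ] at hD
  refine lt_of_mul_lt_mul_right (a := δ) ?_ hδ.le
  calc 4 ^ 2 * N * D ^ 2 * (64 * N ^ 2) ^ 2 * δ = 65536 * N ^ 5 * (D ^ 2 * δ) := by ring
    _ ≤ 65536 * N ^ 5 * (B * N) := by gcongr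
    _ = 65536 * B * N ^ 6 := by ring
    _ < _ := h
    _ = _ := by ring

/-- Here `q` stands for `log(mn/δ)` and `ℓ` for `log(m/δ)`. The logarithm in the width condition is
needed for this bound. -/
theorem sign_radius_lt {N μ lam δ B D ℓ q : ℝ} (hN : 1 ≤ N) (hμ : 0 < μ) (hlam : 0 < lam)
    (hδ : 0 < δ) (hB : 0 ≤ B) (hq : 0 ≤ q) (hqℓ : q ≤ 2 * ℓ) (hD : D ^ 2 ≤ B * N / δ)
    (h : 8192 * B * N ^ 2 * ℓ < μ * lam ^ 2 * δ) :
    8 * Real.sqrt N * D * Real.sqrt q / (Real.sqrt μ * lam) < 1 / 8 := by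
  refine lt_of_pow_lt_pow_left₀ 2 (by positivity) ?_
  rw [div_pow, mul_pow, mul_pow, mul_pow, mul_pow _ lam, Real.sq_sqrt (by linarith),
    Real.sq_sqrt hμ.le, Real.sq_sqrt hq, div_pow, one_pow,
    div_lt_div_iff₀ (by positivity) (by positivity)]
  have hD' : D ^ 2 * δ ≤ B * N := by rwa [le_div_iff₀ hδ] at hD
  refine lt_of_mul_lt_mul_right (a := δ) ?_ hδ.le
  calc 8 ^ 2 * N * D ^ 2 * q * 8 ^ 2 * δ = 4096 * N * q * (D ^ 2 * δ) := by ring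
    _ ≤ 4096 * N * q * (B * N) := by gcongr
    _ ≤ 4096 * N * (2 * ℓ) * (B * N) := by gcongr
    _ = 8192 * B * N ^ 2 * ℓ := by ring
    _ < _ := h
    _ = _ := by ring

end TwoLayerReLU

/-! ### Choice of the constants and the main theorem -/

theorem theorem3p3 (C : ℝ) :
    ∃ K : ℝ, 0 < K ∧
      ∀ (n d m : ℕ) (x : Fin n → EuclideanSpace ℝ (Fin d)) (y : EuclideanSpace ℝ (Fin n))
        (lam0 δ : ℝ),
        0 < n → 2 ≤ m → 0 < δ → δ < 1 →
        (∀ i, ‖x i‖ = 1) → (∀ i, |y i| ≤ C) →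
        lam0 = TwoLayerReLU.lambdaMin (TwoLayerReLU.gramInf x) → 0 < lam0 →
        K * ((n : ℝ) ^ 6 * Real.log (m / δ) / (lam0 ^ 4 * δ ^ 3)) ≤ m →
        ∃ E : Set ((Fin m → EuclideanSpace ℝ (Fin d)) × (Fin m → ℝ)),
          MeasurableSet E ∧
          ENNReal.ofReal (1 - δ) ≤ TwoLayerReLU.initLaw m d E ∧
          ∀ (T : ℝ) (W : ℝ → Fin m → EuclideanSpace ℝ (Fin d)) (a : ℝ → Fin m → ℝ),
            0 ≤ T → (W 0, a 0) ∈ E → TwoLayerReLU.IsGradientFlow x y T W a →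
            ∀ t ∈ Set.Icc (0 : ℝ) T,
              ‖TwoLayerReLU.prediction x (W t) (a t) - y‖ ^ 2 ≤
                  Real.exp (-lam0 * t) * ‖TwoLayerReLU.prediction x (W 0) (a 0) - y‖ ^ 2 ∧
              (∀ r, ‖W t r - W 0 r‖ ≤
                4 * Real.sqrt n * ‖y - TwoLayerReLU.prediction x (W 0) (a 0)‖ /
                  (Real.sqrt m * lam0)) ∧
              (∀ r, |a t r - a 0 r| ≤
                8 * Real.sqrt n * ‖y - TwoLayerReLU.prediction x (W 0) (a 0)‖ *
                    Real.sqrt (Real.log (m * n / δ)) /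
                  (Real.sqrt m * lam0)) := by
  -- `B = 8(1 + C²)` comes from `‖y - u(0)‖² ≤ 2 · 4n/δ + 2nC² ≤ B n/δ`.
  refine ⟨2 ^ 18 * (8 * (1 + C ^ 2)), by positivity, ?_⟩
  intro n d m x y lam δ hn hm2 hδ hδ1 hx hy hlam_eq hlam hwidth
  have hm : 0 < m := by omega
  have hm' : (2 : ℝ) ≤ m := by exact_mod_cast hm2
  have hμ : (0 : ℝ) < m := by linarith
  have hN : (1 : ℝ) ≤ n := by exact_mod_cast hn
  have hB : 8 ≤ 8 * (1 + C ^ 2) := by nlinarith [sq_nonneg C]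
  have hlam1 : lam ≤ 1 := hlam_eq ▸ TwoLayerReLU.lambdaMin_gramInf_le_one hx hn
  have hlog2 : 1 / 2 ≤ Real.log 2 := by linarith [Real.log_two_gt_d9]
  have hquot : (2 : ℝ) ≤ m / δ := by
    rw [le_div_iff₀ hδ]
    nlinarith
  have hℓ : 1 / 2 ≤ Real.log (m / δ) := hlog2.trans (Real.log_le_log two_pos hquot)
  obtain ⟨hNm, hgram, hweight, hsign⟩ :=
    TwoLayerReLU.width_bounds hN hμ hlam hlam1 hδ hδ1 hB hℓ hwidth
  set q : ℝ := m * n / δ with hq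
  have hq_eq : q = m / δ * n := by rw [hq]; ring
  have hquot_q : m / δ ≤ q := by
    rw [hq_eq]
    exact le_mul_of_one_le_right (by positivity) hN
  have hq2 : 2 ≤ q := hquot.trans hquot_q
  have hlogq : 1 / 2 ≤ Real.log q := hlog2.trans (Real.log_le_log two_pos hq2)
  -- `n ≤ m ≤ m/δ`, so the extra `log n` at most doubles the logarithm.
  have hlogq_le : Real.log q ≤ 2 * Real.log (m / δ) := by
    have h1 : (n : ℝ) ≤ m / δ := hNm.trans (by rw [le_div_iff₀ hδ]; nlinarith)
    rw [hq_eq, Real.log_mul (by positivity) (by positivity), two_mul]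
    gcongr
  -- Chosen so that the Markov bound `16 n² R / lam` for the margin event is exactly `δ/4`.
  set R : ℝ := δ * lam / (64 * n ^ 2) with hR
  have hR0 : 0 < R := by positivity
  have hML : 3 * Real.sqrt (Real.log q) + R ≤ 4 * Real.sqrt (Real.log q) := by
    have h1 : R ≤ 1 / 64 := by
      rw [hR, div_le_div_iff₀ (by positivity) (by norm_num)]
      have h2 : δ * lam ≤ 1 * 1 := by gcongr
      have h3 : (1 : ℝ) ≤ n ^ 2 := one_le_pow₀ hN
      linarith
    have h2 : 1 / 64 ≤ Real.sqrt (Real.log q) := Real.le_sqrt_of_sq_le (by linarith)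
    linarith
  set bad := TwoLayerReLU.badInit x m (lam / (8 * n)) (m * lam / (16 * n)) R
    (3 * Real.sqrt (Real.log q)) (4 * n / δ) with hbad
  have hmeas : MeasurableSet bad := TwoLayerReLU.measurableSet_badInit x m _ _ _ _ _
  have hprob : (TwoLayerReLU.initLaw m d).real bad ≤ δ := by
    refine (TwoLayerReLU.initLaw_badInit_le hx hm (by positivity) (by positivity) hR0.le
      (by positivity) (by positivity)).trans ?_
    have h1 : (n : ℝ) ^ 2 / (m * (lam / (8 * n)) ^ 2) ≤ δ / 4 := by
      have h2 : (n : ℝ) ^ 2 / (m * (lam / (8 * n)) ^ 2) = 64 * n ^ 4 / (m * lam ^ 2) := by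
        field_simp
        ring
      rw [h2, div_le_div_iff₀ (by positivity) (by norm_num)]
      linarith
    have h2 : m * n * R / (m * lam / (16 * n)) = δ / 4 := by
      rw [hR]
      field_simp
      ring
    have h3 := TwoLayerReLU.tail_le (p := m * n) hδ hq2 (by rw [hq]; field_simp)
    have h4 : n / (4 * n / δ) = δ / 4 := by field_simp
    linarith
  -- The event involves only the initialization, so it serves all `T` and all flows at once.
  refine ⟨badᶜ, hmeas.compl, ?_, ?_⟩
  · rw [← ofReal_measureReal]
    refine ENNReal.ofReal_le_ofReal ?_
    rw [probReal_compl_eq_one_sub hmeas]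
    linarith
  · intro T W a _ hmem hflow t ht
    rw [Set.mem_compl_iff, hbad, hlam_eq] at hmem
    obtain ⟨hinit, hout⟩ := TwoLayerReLU.isGoodInit_of_notMem_badInit hn hmem
    rw [← hlam_eq] at hinit
    have hD : ‖y - TwoLayerReLU.prediction x (W 0) (a 0)‖ ^ 2 ≤ 8 * (1 + C ^ 2) * n / δ := by
      rw [norm_sub_rev]
      refine (TwoLayerReLU.norm_prediction_sub_sq_le hy hout).trans ?_
      rw [le_div_iff₀ hδ, add_mul, mul_div_assoc', div_mul_cancel₀ _ hδ.ne']
      have h1 : 2 * n * C ^ 2 * δ ≤ 2 * n * C ^ 2 * 1 := by gcongr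
      have h2 : 0 ≤ n * C ^ 2 := by positivity
      linarith
    exact hinit.flowBounds hn hm hlam hR0 hx hML
      (TwoLayerReLU.weight_radius_lt hN hμ hlam hδ hD hweight)
      (TwoLayerReLU.sign_radius_lt hN hμ hlam hδ (by linarith) (by linarith) hlogq_le hD hsign)
      hflow ht
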